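/- \textbf{Model.} Let $k,\alpha,\beta>0$, $T_m\in\mathbb R$, $L>0$, and a setpoint $s_r<L$. Consider the one-phase Stefan problem with actuator dynamics $$T_t=\alpha T_{xx}\ (0<x<s(t)),\quad -kT_x(0,t)=q_c(t),\quad T(s(t),t)=T_m,\quad \dot s(t)=-\beta T_x(s(t),t),\quad \dot q_c(t)=U(t)$$ for $t>0$, with $s(0)=s_0$, $T(x,0)=T_0(x)$ for $x\in(0,s_0]$ (classical solutions: $s>0$; $s$ and $q_c$ are continuous for $t\ge0$; $T$ is continuous on $\{t\ge 0,\ 0\le x\le s(t)\}$; $T_x$ is continuous on $\{t>0,\ 0\le x\le s(t)\}$; $T_t,T_{xx}$ are continuous on $\{t>0,\ 0<x<s(t)\}$; at jumps of $U$ the actuator equation is meant with the right derivative). Put $$\sigma(t)=-\Big(\tfrac k\alpha\int_0^{s(t)}(T(x,t)-T_m)\,dx+\tfrac k\beta(s(t)-s_r)\Big),\quad h_2=q_c,\quad h_3=-q_c+c_1\sigma,\quad U^*=-c_1h_2+c_2h_3,$$ with gains $c_1,c_2>0$. \textbf{Event-triggered control.} Let $\delta_1>0$, $\delta_2\in(0,1)$,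 $\mu_1=\min\{\delta_1c_1,(1-\delta_2)c_2\}$. The input is $U(t)=U^*(t_j)$ for $t\in[t_j,t_{j+1})$, where $t_0=0$ and, with $\tilde U^*(t)=U^*(t)-U^*(t_j)$, $$t_{j+1}=\inf\big\{t>t_j:\ -\delta_2c_2h_3(t)>\tilde U^*(t)\ \text{ or }\ \tilde U^*(t)>\mu_1h_2(t)+\delta_2c_2h_3(t)\big\}\qquad(\inf\emptyset=\infty),$$ the signals in this set being evaluated along the motion of the plant from its state at time $t_j$ with the input held at $U^*(t_j)$. \textbf{Theorem.} For all parameters as above there exist constants $M>0$ and $b>0$, depending only on $k,\alpha,\beta,T_m,L,s_r,c_1,c_2,\delta_1,\delta_2$ and not on the initial condition, such that the following holds. Suppose that - $0<s_0<L$, $T_0\in C^1([0,s_0];[T_m,\infty))$, $T_0(s_0)=T_m$; - $q_c(0)\ge0$; - $s_0+\frac\beta\alpha\int_0^{s_0}(T_0(x)-T_m)\,dx\le s_r$; - $q_c(0)\le c_1\,\sigma(0)$ (for $\sigma(0)>0$ this is $c_1\ge q_c(0)/\sigma(0)$). Then every solution of the closed-loop system on a time interval $[0,t_{\rm end})$,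 $0<t_{\rm end}\le\infty$, satisfies $$\Phi(t)\le M\,\Phi(0)\,e^{-bt}\quad\text{for all }t\in[0,t_{\rm end}),\qquad \Phi(t):=\int_0^{s(t)}(T(x,t)-T_m)^2dx+(s(t)-s_r)^2+q_c(t)^2.$$ In particular, with $t_{\rm end}=\infty$, the closed-loop system is globally (for all initial conditions in the safe set) exponentially stable at the equilibrium $s=s_r$, $T\equiv T_m$, $q_c=0$. -/

import Mathlib

open Set

noncomputable section

/-- Physical constants of the one-phase Stefan model: thermal conductivity `k`, diffusivity `α`,
interface coefficient `β`, melting temperature `Tm`. -/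
structure StefanParams where
  k : ℝ
  α : ℝ
  β : ℝ
  Tm : ℝ

/-- Parameters of the event-triggered controller: feedback gains `c₁, c₂` and triggering
parameters `δ₁, δ₂`. -/
structure ETCGains where
  c₁ : ℝ
  c₂ : ℝ
  δ₁ : ℝ
  δ₂ : ℝ

/-- Spatial derivative `T_x(x,t)` on the liquid phase `[0, s(t)]`, one-sided at the end points. -/
def spaceDeriv (T : ℝ → ℝ → ℝ) (s : ℝ → ℝ) (x t : ℝ) : ℝ :=
  derivWithin (fun y => T y t) (Icc 0 (s t)) x

/-- `(T, s, q)` is a classical solution, on the time interval `[a, b)`, of the one-phase Stefan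
problem driven through the actuator `q̇ = U`. Here `b` may be `⊤`; `T x t` is only meaningful
for `0 ≤ x ≤ s t`. The regularity is the classical one: `T` is continuous up to the parabolic
boundary, `T_x` is continuous up to the lateral boundary for positive elapsed time, and
`T_t`, `T_xx` exist and are continuous in the interior. The actuator equation uses the right
derivative of the continuous function `q`, since `U` may jump. -/
structure IsStefanSolution (P : StefanParams) (T : ℝ → ℝ → ℝ) (s q U : ℝ → ℝ)
    (a : ℝ) (b : EReal) : Prop where
  s_pos : ∀ t : ℝ, a ≤ t → (t : EReal) < b → 0 < s t
  s_cont : ContinuousOn s {t : ℝ | a ≤ t ∧ (t : EReal) < b}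
  T_cont : ContinuousOn (fun p : ℝ × ℝ => T p.1 p.2)
    {p : ℝ × ℝ | a ≤ p.2 ∧ (p.2 : EReal) < b ∧ 0 ≤ p.1 ∧ p.1 ≤ s p.2}
  T_diff_x : ∀ t : ℝ, a < t → (t : EReal) < b →
    DifferentiableOn ℝ (fun x => T x t) (Icc 0 (s t))
  Tx_cont : ContinuousOn (fun p : ℝ × ℝ => spaceDeriv T s p.1 p.2)
    {p : ℝ × ℝ | a < p.2 ∧ (p.2 : EReal) < b ∧ 0 ≤ p.1 ∧ p.1 ≤ s p.2}
  T_diff_xx : ∀ t x : ℝ, a < t → (t : EReal) < b → 0 < x → x < s t →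
    DifferentiableAt ℝ (fun y => spaceDeriv T s y t) x
  T_diff_t : ∀ t x : ℝ, a < t → (t : EReal) < b → 0 < x → x < s t →
    DifferentiableAt ℝ (fun r => T x r) t
  Tt_cont : ContinuousOn (fun p : ℝ × ℝ => deriv (fun r => T p.1 r) p.2)
    {p : ℝ × ℝ | a < p.2 ∧ (p.2 : EReal) < b ∧ 0 < p.1 ∧ p.1 < s p.2}
  Txx_cont : ContinuousOn (fun p : ℝ × ℝ => deriv (fun y => spaceDeriv T s y p.2) p.1)
    {p : ℝ × ℝ | a < p.2 ∧ (p.2 : EReal) < b ∧ 0 < p.1 ∧ p.1 < s p.2}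
  /-- heat equation -/
  heat : ∀ t x : ℝ, a < t → (t : EReal) < b → 0 < x → x < s t →
    deriv (fun r => T x r) t = P.α * deriv (fun y => spaceDeriv T s y t) x
  /-- heat flux at the fixed boundary -/
  flux : ∀ t : ℝ, a < t → (t : EReal) < b → -P.k * spaceDeriv T s 0 t = q t
  /-- melting temperature at the interface -/
  melt : ∀ t : ℝ, a < t → (t : EReal) < b → T (s t) t = P.Tm
  /-- interface dynamics -/
  interface : ∀ t : ℝ, a < t → (t : EReal) < b →
    HasDerivAt s (-P.β * spaceDeriv T s (s t) t) t
  q_cont : ContinuousOn q {t : ℝ | a ≤ t ∧ (t : EReal) < b}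
  /-- actuator dynamics -/
  actuator : ∀ t : ℝ, a ≤ t → (t : EReal) < b → HasDerivWithinAt q (U t) (Ici t) t

/-- The energy deficit
`σ(t) = -((k/α) ∫₀^{s(t)} (T(x,t) - Tm) dx + (k/β) (s(t) - sr))`, i.e. `h₁`. -/
def energyDeficit (P : StefanParams) (sr : ℝ) (T : ℝ → ℝ → ℝ) (s : ℝ → ℝ) (t : ℝ) : ℝ :=
  -(P.k / P.α * (∫ x in (0 : ℝ)..(s t), (T x t - P.Tm)) + P.k / P.β * (s t - sr))

/-- `h₃(t) = -q(t) + c₁ σ(t)`; recall that `h₂ = q`. -/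
def barrierThree (P : StefanParams) (G : ETCGains) (sr : ℝ) (T : ℝ → ℝ → ℝ) (s q : ℝ → ℝ)
    (t : ℝ) : ℝ :=
  -q t + G.c₁ * energyDeficit P sr T s t

/-- The continuous-time control law `U*(t) = -c₁ h₂(t) + c₂ h₃(t)`. -/
def nominalControl (P : StefanParams) (G : ETCGains) (sr : ℝ) (T : ℝ → ℝ → ℝ) (s q : ℝ → ℝ)
    (t : ℝ) : ℝ :=
  -G.c₁ * q t + G.c₂ * barrierThree P G sr T s q t

/-- `μ₁ = min {δ₁ c₁, (1 - δ₂) c₂}`. -/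
def ETCGains.μ₁ (G : ETCGains) : ℝ := min (G.δ₁ * G.c₁) ((1 - G.δ₂) * G.c₂)

/-- The triggering inequality at time `t`, along the signals `(T, s, q)`, with last event at `a`:
`-δ₂ c₂ h₃(t) > Ũ*(t)` or `Ũ*(t) > μ₁ h₂(t) + δ₂ c₂ h₃(t)`, where `Ũ*(t) = U*(t) - U*(a)`. -/
def Triggered (P : StefanParams) (G : ETCGains) (sr : ℝ) (T : ℝ → ℝ → ℝ) (s q : ℝ → ℝ)
    (a t : ℝ) : Prop :=
  -G.δ₂ * G.c₂ * barrierThree P G sr T s q t >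
      nominalControl P G sr T s q t - nominalControl P G sr T s q a ∨
    nominalControl P G sr T s q t - nominalControl P G sr T s q a >
      G.μ₁ * q t + G.δ₂ * G.c₂ * barrierThree P G sr T s q t

/-- The set of times `t > a` at which the triggering inequality holds along the motion of the
plant which starts at time `a` in the state `(T(·,a), s(a), q(a))` and has its input held at the
value `U*(a)`. Up to the next event this motion is the closed-loop trajectory itself; beyond that
event it is the continuation that would occur without an update of the input. -/
def triggerSet (P : StefanParams) (G : ETCGains) (sr : ℝ) (T : ℝ → ℝ → ℝ) (s q : ℝ → ℝ)
    (a : ℝ) : Set ℝ :=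
  {t : ℝ | a < t ∧ ∃ (T' : ℝ → ℝ → ℝ) (s' q' : ℝ → ℝ) (b : ℝ), t < b ∧
    IsStefanSolution P T' s' q' (fun _ => nominalControl P G sr T s q a) a b ∧
    s' a = s a ∧ q' a = q a ∧ (∀ x ∈ Icc 0 (s a), T' x a = T x a) ∧
    Triggered P G sr T' s' q' a t}

/-- `(T, s, q)` is a solution on `[0, tEnd)` of the closed loop: the plant driven by `U`, where
`U` is the zero-order hold of `U*` over the event times `e 0 < e 1 < …` generated by the
triggering rule. An event time equal to `⊤` means that there is no further event
(the infimum of the empty set is `⊤` in `EReal`). -/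
structure IsClosedLoopSolution (P : StefanParams) (G : ETCGains) (sr : ℝ) (T : ℝ → ℝ → ℝ)
    (s q U : ℝ → ℝ) (e : ℕ → EReal) (tEnd : EReal) : Prop where
  plant : IsStefanSolution P T s q U 0 tEnd
  event_zero : e 0 = 0
  event_succ : ∀ (j : ℕ) (a : ℝ), e j = (a : EReal) →
    e (j + 1) = sInf ((fun t : ℝ => (t : EReal)) '' triggerSet P G sr T s q a)
  event_top : ∀ j : ℕ, e j = ⊤ → e (j + 1) = ⊤
  hold : ∀ (j : ℕ) (a : ℝ), e j = (a : EReal) → ∀ t : ℝ, a ≤ t → (t : EReal) < e (j + 1) →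
    (t : EReal) < tEnd → U t = nominalControl P G sr T s q a

/-- `Φ(t) = ‖T[t] - Tm‖² + (s(t) - sr)² + q(t)²`, with the `L²(0, s(t))` norm. -/
def stabilityNorm (P : StefanParams) (sr : ℝ) (T : ℝ → ℝ → ℝ) (s q : ℝ → ℝ) (t : ℝ) : ℝ :=
  (∫ x in (0 : ℝ)..(s t), (T x t - P.Tm) ^ 2) + (s t - sr) ^ 2 + q t ^ 2

end

/-!
`V = (μ₁ + c₁) σ + h₃` and the heat energy `Y = ∫ (T - Tm)²` form a Lyapunov cascade. By heat
balance `σ' = -q`, so `(σ, q)` obeys an ODE whatever the temperature does, and the triggering rule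
makes `V` decay exponentially. The temperature is driven by `q` alone, and `q ≤ V`: the Poincaré
inequality on `(0, s) ⊆ (0, sr)` gives `Y' ≤ -κ Y + C V²`. Hence `Y + K V²` decays for suitable `K`.

This uses that the state stays in the set `T ≥ Tm`, `h₂ ≥ 0`, `h₃ ≥ 0`, on which `Y + K V²` is
equivalent to `Φ`. While the input is held, `q` is affine and `σ` quadratic in time, so that the
next event comes after a dwell time bounded below uniformly, which excludes Zeno behaviour; between
events the bounds on the input deviation keep `h₂` and `h₃` nonnegative, and a heat flux `q ≥ 0`
keeps `T ≥ Tm` because `∫ min (T - Tm) 0 ^ 4` cannot increase.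

As `T_t` and `T_xx` may blow up at the boundary, every energy identity is first derived on
`[ε, s - ε]`; as `ε → 0` the time derivatives converge locally uniformly.
-/

open Filter Topology MeasureTheory

section RightDerivative

variable {f g f' : ℝ → ℝ} {a b c : ℝ}

theorem le_of_rightDeriv_nonpos (hab : a ≤ b) (hf : ContinuousOn f (Icc a b))
    (hd : ∀ t ∈ Ioo a b, HasDerivWithinAt f (f' t) (Ici t) t)
    (hn : ∀ t ∈ Ioo a b, f' t ≤ 0) : f b ≤ f a := by
  rcases hab.eq_or_lt with rfl | hlt
  · exact le_rfl
  have le_of_mem : ∀ c ∈ Ioo a b, f b ≤ f c := fun c hc =>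
    image_le_of_deriv_right_le_deriv_boundary (f' := f') (B := fun _ => f c) (B' := fun _ => 0)
      (hf.mono (Icc_subset_Icc_left hc.1.le)) (fun t ht => hd t ⟨hc.1.trans_le ht.1, ht.2⟩) le_rfl
      continuousOn_const (fun t _ => hasDerivWithinAt_const t _ _)
      (fun t ht => hn t ⟨hc.1.trans_le ht.1, ht.2⟩) ⟨hc.2.le, le_rfl⟩
  have tendsto_left : Tendsto f (𝓝[Ioo a b] a) (𝓝 (f a)) :=
    (hf a ⟨le_rfl, hab⟩).mono Ioo_subset_Icc_self
  have : (𝓝[Ioo a b] a).NeBot := by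
    rw [nhdsWithin_Ioo_eq_nhdsGT hlt]; infer_instance
  exact ge_of_tendsto tendsto_left (eventually_mem_nhdsWithin.mono le_of_mem)

theorem sub_eq_sub_of_rightDeriv_eq (hab : a ≤ b)
    (hf : ContinuousOn f (Icc a b)) (hg : ContinuousOn g (Icc a b))
    (hfd : ∀ t ∈ Ioo a b, HasDerivWithinAt f (f' t) (Ici t) t)
    (hgd : ∀ t ∈ Ioo a b, HasDerivWithinAt g (f' t) (Ici t) t) : f b - f a = g b - g a := by
  have hle := le_of_rightDeriv_nonpos hab (hf.sub hg)
    (fun t ht => (hfd t ht).sub (hgd t ht)) (fun t _ => (sub_self _).le)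
  have hge := le_of_rightDeriv_nonpos hab (hg.sub hf)
    (fun t ht => (hgd t ht).sub (hfd t ht)) (fun t _ => (sub_self _).le)
  simp only [Pi.sub_apply] at hle hge
  linarith

theorem le_mul_exp_of_rightDeriv_le (hab : a ≤ b) (hf : ContinuousOn f (Icc a b))
    (hd : ∀ t ∈ Ioo a b, HasDerivWithinAt f (f' t) (Ici t) t)
    (hn : ∀ t ∈ Ioo a b, f' t ≤ -c * f t) : f b ≤ f a * Real.exp (-c * (b - a)) := by
  have key := le_of_rightDeriv_nonpos (f := fun t => f t * Real.exp (c * (t - a)))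
    (f' := fun t => f' t * Real.exp (c * (t - a)) + f t * (Real.exp (c * (t - a)) * c)) hab
    (hf.mul (by fun_prop)) (fun t ht => ?_) (fun t ht => ?_)
  · simp only [sub_self, mul_zero, Real.exp_zero, mul_one] at key
    calc f b = f b * Real.exp (c * (b - a)) * Real.exp (-c * (b - a)) := by
          rw [mul_assoc, ← Real.exp_add]; simp
      _ ≤ _ := mul_le_mul_of_nonneg_right key (Real.exp_pos _).le
  · have hexp := (((hasDerivAt_id t).sub_const a).const_mul c).exp
    exact (hd t ht).mul (by simpa using hexp.hasDerivWithinAt)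
  · have := mul_le_mul_of_nonneg_right (hn t ht) (Real.exp_pos (c * (t - a))).le
    nlinarith

theorem nonneg_of_le_rightDeriv (hab : a ≤ b) (hf : ContinuousOn f (Icc a b))
    (hd : ∀ t ∈ Ioo a b, HasDerivWithinAt f (f' t) (Ici t) t)
    (hn : ∀ t ∈ Ioo a b, -c * f t ≤ f' t) (h0 : 0 ≤ f a) : 0 ≤ f b := by
  have hneg := le_mul_exp_of_rightDeriv_le (f := -f) (f' := fun t => -f' t) (c := c) hab hf.neg
    (fun t ht => (hd t ht).neg) (fun t ht => by
      simpa using neg_le_neg (hn t ht))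
  have hexp := mul_nonneg h0 (Real.exp_pos (-c * (b - a))).le
  simp only [Pi.neg_apply] at hneg
  linarith

end RightDerivative

section ParametricIntegral

variable {E : Type*} [NormedAddCommGroup E] [NormedSpace ℝ E]
  {f f' : ℝ → ℝ → E} {I J : Set ℝ} {c d t : ℝ}

theorem hasDerivAt_intervalIntegral_of_continuousOn (hcd : uIcc c d ⊆ I) (hJ : J ∈ 𝓝 t)
    (hf : ContinuousOn (fun p : ℝ × ℝ => f p.1 p.2) (I ×ˢ J))
    (hf' : ContinuousOn (fun p : ℝ × ℝ => f' p.1 p.2) (I ×ˢ J))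
    (hd : ∀ x ∈ I, ∀ r ∈ J, HasDerivAt (f x) (f' x r) r) :
    HasDerivAt (fun r => ∫ x in c..d, f x r) (∫ x in c..d, f' x t) t := by
  obtain ⟨K, hKt, hKJ, hK⟩ := local_compact_nhds hJ
  obtain ⟨C, hC⟩ := (isCompact_uIcc.prod hK).exists_bound_of_continuousOn
    (hf'.mono (prod_mono hcd hKJ))
  have slice : ∀ {g : ℝ → ℝ → E}, ContinuousOn (fun p : ℝ × ℝ => g p.1 p.2) (I ×ˢ J) →
      ∀ r ∈ J, ContinuousOn (fun x => g x r) (uIcc c d) := fun hg r hr =>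
    hg.comp (f := fun x => (x, r)) (by fun_prop) fun x hx => ⟨hcd hx, hr⟩
  have measurable_slice : ∀ {g : ℝ → E}, ContinuousOn g (uIcc c d) →
      AEStronglyMeasurable g (volume.restrict (uIoc c d)) := fun hg =>
    (hg.mono uIoc_subset_uIcc).aestronglyMeasurable measurableSet_uIoc
  refine (intervalIntegral.hasDerivAt_integral_of_dominated_loc_of_deriv_le
    (F := fun r x => f x r) (F' := fun r x => f' x r) (bound := fun _ => C) hKt
    ?_ ?_ ?_ ?_ intervalIntegrable_const ?_).2
  · filter_upwards [hJ] with r hr using measurable_slice (slice hf r hr)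
  · exact (slice hf t (mem_of_mem_nhds hJ)).intervalIntegrable
  · exact measurable_slice (slice hf' t (mem_of_mem_nhds hJ))
  · exact ae_of_all _ fun x hx r hr => hC (x, r) ⟨uIoc_subset_uIcc hx, hr⟩
  · exact ae_of_all _ fun x hx r hr => hd x (hcd (uIoc_subset_uIcc hx)) r (hKJ hr)

theorem hasDerivAt_integral_to_moving_endpoint [CompleteSpace E] {g : ℝ → ℝ} {g' : ℝ}
    (hI : IsOpen I) (hgt : g t ∈ I) (hJ : J ∈ 𝓝 t)
    (hf : ContinuousOn (fun p : ℝ × ℝ => f p.1 p.2) (I ×ˢ J)) (hg : HasDerivAt g g' t) :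
    HasDerivAt (fun r => ∫ x in g t..g r, f x r) (g' • f (g t) t) t := by
  have hbox : I ×ˢ J ∈ 𝓝 (g t, t) := prod_mem_nhds (hI.mem_nhds hgt) hJ
  have mean_value : (fun r => (∫ x in g t..g r, f x r) - (g r - g t) • f (g t) t)
      =o[𝓝 t] fun r => g r - g t := by
    refine Asymptotics.isLittleO_iff.2 fun ε hε => ?_
    have hnear : ∀ᶠ p in 𝓝 (g t, t), p ∈ I ×ˢ J ∧ ‖f p.1 p.2 - f (g t) t‖ ≤ ε :=
      (eventually_mem_set.2 hbox).and <| ((hf.continuousAt hbox).eventually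
        (Metric.closedBall_mem_nhds _ hε)).mono fun p hp => mem_closedBall_iff_norm.1 hp
    obtain ⟨A, hA, B, hB, hAB⟩ := mem_nhds_prod_iff.1 hnear
    obtain ⟨η, hη, hηA⟩ := Metric.nhds_basis_ball.mem_iff.1 hA
    filter_upwards [hB, hg.continuousAt (Metric.ball_mem_nhds _ hη)] with r hr hgr
    have hmem : ∀ x ∈ uIcc (g t) (g r), x ∈ A := fun x hx =>
      hηA ((convex_ball (g t) η).ordConnected.uIcc_subset (Metric.mem_ball_self hη) hgr hx)
    have hint : IntervalIntegrable (fun x => f x r) volume (g t) (g r) :=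
      (hf.comp (f := fun x => (x, r)) (by fun_prop)
        fun x hx => (hAB ⟨hmem x hx, hr⟩).1).intervalIntegrable
    rw [← intervalIntegral.integral_const, ← intervalIntegral.integral_sub hint (by simp)]
    exact intervalIntegral.norm_integral_le_of_norm_le_const fun x hx =>
      (@hAB (x, r) ⟨hmem x (uIoc_subset_uIcc hx), hr⟩).2
  have remainder : HasDerivAt
      (fun r => (∫ x in g t..g r, f x r) - (g r - g t) • f (g t) t) 0 t := by
    simpa [hasDerivAt_iff_isLittleO] using mean_value.trans_isBigO hg.isBigO_sub
  exact ((remainder.add ((hg.sub_const (g t)).smul_const (f (g t) t))).congr_deriv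
    (zero_add _)).congr_of_eventuallyEq (.of_forall fun _ => (sub_add_cancel _ _).symm)

theorem hasDerivAt_integral_of_moving_endpoint [CompleteSpace E] {g : ℝ → ℝ} {g' : ℝ}
    (hI : IsOpen I) (hI' : I.OrdConnected) (hcI : c ∈ I) (hgt : g t ∈ I) (hJ : J ∈ 𝓝 t)
    (hf : ContinuousOn (fun p : ℝ × ℝ => f p.1 p.2) (I ×ˢ J))
    (hf' : ContinuousOn (fun p : ℝ × ℝ => f' p.1 p.2) (I ×ˢ J))
    (hd : ∀ x ∈ I, ∀ r ∈ J, HasDerivAt (f x) (f' x r) r) (hg : HasDerivAt g g' t) :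
    HasDerivAt (fun r => ∫ x in c..g r, f x r)
      ((∫ x in c..g t, f' x t) + g' • f (g t) t) t := by
  have hfixed := hasDerivAt_intervalIntegral_of_continuousOn (hI'.uIcc_subset hcI hgt) hJ hf hf' hd
  refine (hfixed.add (hasDerivAt_integral_to_moving_endpoint hI hgt hJ hf hg)).congr_of_eventuallyEq
    ?_
  filter_upwards [hJ, hg.continuousAt (hI.mem_nhds hgt)] with r hr hgr
  have hint : ∀ u ∈ I, ∀ v ∈ I, IntervalIntegrable (fun x => f x r) volume u v := fun u hu v hv =>
    (hf.comp (f := fun x => (x, r)) (by fun_prop)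
      fun x hx => ⟨hI'.uIcc_subset hu hv hx, hr⟩).intervalIntegrable
  exact (intervalIntegral.integral_add_adjacent_intervals (hint _ hcI _ hgt)
    (hint _ hgt _ hgr)).symm

end ParametricIntegral

theorem continuous_integral_between {g : ℝ × ℝ → ℝ} (hg : Continuous g) :
    Continuous fun p : (ℝ × ℝ) × ℝ => ∫ x in p.1.1..p.1.2, g (x, p.2) := by
  have primitive : ∀ e : (ℝ × ℝ) × ℝ → ℝ, Continuous e →
      Continuous fun p : (ℝ × ℝ) × ℝ => ∫ x in (0 : ℝ)..e p, g (x, p.2) := fun e he =>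
    intervalIntegral.continuous_parametric_intervalIntegral_of_continuous
      (f := fun (p : (ℝ × ℝ) × ℝ) x => g (x, p.2))
      (hg.comp (f := fun y : ((ℝ × ℝ) × ℝ) × ℝ => (y.2, y.1.2)) (by fun_prop)) he
  have hint : ∀ t u v : ℝ, IntervalIntegrable (fun x => g (x, t)) volume u v := fun t u v =>
    (hg.comp (f := fun x : ℝ => (x, t)) (by fun_prop)).intervalIntegrable u v
  exact ((primitive _ (by fun_prop)).sub (primitive _ (by fun_prop))).congr fun p =>
    intervalIntegral.integral_interval_sub_left (hint _ _ _) (hint _ _ _)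

theorem continuousOn_integral_fiber {Z : Type*} [TopologicalSpace Z] {f : ℝ → ℝ → ℝ}
    {D : Set (ℝ × ℝ)} {A : Set Z} {c d r : Z → ℝ} (hD : IsClosed D)
    (hfiber : ∀ t, {x | (x, t) ∈ D}.OrdConnected)
    (hf : ContinuousOn (fun p : ℝ × ℝ => f p.1 p.2) D) (hc : ContinuousOn c A)
    (hd : ContinuousOn d A) (hr : ContinuousOn r A) (hcD : ∀ z ∈ A, (c z, r z) ∈ D)
    (hdD : ∀ z ∈ A, (d z, r z) ∈ D) :
    ContinuousOn (fun z => ∫ x in c z..d z, f x (r z)) A := by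
  obtain ⟨g, hg⟩ := ContinuousMap.exists_restrict_eq hD ⟨_, hf.domRestrict⟩
  have g_eq : ∀ p ∈ D, g p = f p.1 p.2 := fun p hp => DFunLike.congr_fun hg ⟨p, hp⟩
  refine ((continuous_integral_between g.continuous).comp_continuousOn
    ((hc.prodMk hd).prodMk hr)).congr fun z hz => ?_
  exact intervalIntegral.integral_congr fun x hx =>
    (g_eq _ ((hfiber (r z)).uIcc_subset (hcD z hz) (hdD z hz) hx)).symm

theorem hasDerivAt_of_tendsto_of_continuousOn_deriv {F F' : ℝ → ℝ → ℝ} {m t : ℝ} {J : Set ℝ}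
    (hm : 0 < m) (hJ : IsOpen J) (ht : t ∈ J)
    (hF' : ContinuousOn (fun p : ℝ × ℝ => F' p.1 p.2) (Ico 0 m ×ˢ J))
    (hd : ∀ ε ∈ Ioo 0 m, ∀ r ∈ J, HasDerivAt (F ε) (F' ε r) r)
    (hF : ∀ r ∈ J, Tendsto (fun ε => F ε r) (𝓝[>] 0) (𝓝 (F 0 r))) :
    HasDerivAt (F 0) (F' 0 t) t := by
  refine hasDerivAt_of_tendstoLocallyUniformlyOn (l := 𝓝[>] (0 : ℝ)) (f := F) (f' := F') hJ ?_
    (eventually_of_mem (Ioo_mem_nhdsGT hm) hd) hF ht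
  rw [tendstoLocallyUniformlyOn_iff_forall_tendsto]
  intro r hr
  have hmem : ((0 : ℝ), r) ∈ Ico 0 m ×ˢ J := ⟨⟨le_rfl, hm⟩, hr⟩
  have joint : Tendsto (fun p : ℝ × ℝ => F' p.1 p.2) (𝓝[>] 0 ×ˢ 𝓝[J] r) (𝓝 (F' 0 r)) := by
    refine (hF' _ hmem).mono_left ?_
    rw [nhdsWithin_prod_eq, ← nhdsWithin_Ioo_eq_nhdsGT hm]
    exact prod_mono (nhdsWithin_mono _ Ioo_subset_Ico_self) le_rfl
  have limit : Tendsto (fun p : ℝ × ℝ => F' 0 p.2) (𝓝[>] 0 ×ˢ 𝓝[J] r) (𝓝 (F' 0 r)) :=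
    ((hF'.comp (f := fun r => ((0 : ℝ), r)) (by fun_prop) fun r hr => ⟨⟨le_rfl, hm⟩, hr⟩)
      r hr).tendsto.comp tendsto_snd
  exact tendsto_uniformity_iff_dist_tendsto_zero.2 (by simpa using limit.dist joint)

theorem hasDerivAt_min_zero_pow (n : ℕ) (x : ℝ) :
    HasDerivAt (fun x : ℝ => min x 0 ^ (n + 2)) ((n + 2) * min x 0 ^ (n + 1)) x := by
  refine hasDerivAt_of_hasDerivAt_of_ne' (g := fun y => (n + 2) * min y 0 ^ (n + 1))
    (x := 0) (fun y hy => ?_) (by fun_prop) (by fun_prop) x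
  rcases hy.lt_or_gt with hneg | hpos
  · rw [min_eq_left hneg.le]
    refine ((hasDerivAt_pow (n + 2) y).congr_deriv (by simp)).congr_of_eventuallyEq ?_
    filter_upwards [Iio_mem_nhds hneg] with z hz
    rw [min_eq_left (le_of_lt hz)]
  · rw [min_eq_right hpos.le]
    refine ((hasDerivAt_const y (0 : ℝ)).congr_deriv (by simp)).congr_of_eventuallyEq ?_
    filter_upwards [Ioi_mem_nhds hpos] with z hz
    rw [min_eq_right (le_of_lt hz), zero_pow (by simp)]

theorem add_le_mul_add_mul {x y K : ℝ} (hx : 0 ≤ x) (hy : 0 ≤ y) (hK : 0 < K) :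
    x + y ≤ (1 + 1 / K) * (x + K * y) := by
  have : (1 + 1 / K) * (x + K * y) = x + y + (x / K + K * y) := by field_simp; ring
  rw [this]
  exact le_add_of_nonneg_right (by positivity)

theorem add_mul_le_mul_add {x y K : ℝ} (hx : 0 ≤ x) (hy : 0 ≤ y) (hK : 0 ≤ K) :
    x + K * y ≤ (1 + K) * (x + y) := by
  linear_combination mul_nonneg hK hx + hy

theorem add_sq_le_mul_exp_of_cascade {Y V Y' V' : ℝ → ℝ} {a b κ C l : ℝ} (hl : 0 < l)
    (hC : 0 ≤ C) (hab : a ≤ b) (hYc : ContinuousOn Y (Icc a b)) (hVc : ContinuousOn V (Icc a b))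
    (hYd : ∀ t ∈ Ioo a b, HasDerivWithinAt Y (Y' t) (Ici t) t)
    (hVd : ∀ t ∈ Ioo a b, HasDerivWithinAt V (V' t) (Ici t) t)
    (hY : ∀ t ∈ Ioo a b, 0 ≤ Y t) (hV : ∀ t ∈ Ioo a b, 0 ≤ V t)
    (hY' : ∀ t ∈ Ioo a b, Y' t ≤ -κ * Y t + C * V t ^ 2)
    (hV' : ∀ t ∈ Ioo a b, V' t ≤ -l * V t) :
    Y b + C / l * V b ^ 2 ≤ (Y a + C / l * V a ^ 2) * Real.exp (-min κ l * (b - a)) := by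
  have hw : 0 ≤ C / l := div_nonneg hC hl.le
  refine le_mul_exp_of_rightDeriv_le (f := fun t => Y t + C / l * V t ^ 2)
    (f' := fun t => Y' t + C / l * (2 * V t * V' t)) hab
    (hYc.add ((hVc.pow 2).const_mul _)) (fun t ht => ?_) (fun t ht => ?_)
  · exact (hYd t ht).add (by simpa using ((hVd t ht).pow 2).const_mul (C / l))
  · have hlC : C / l * l = C := div_mul_cancel₀ C hl.ne'
    have hVV' : C / l * (2 * V t * V' t) ≤ C / l * (2 * V t * (-l * V t)) :=
      mul_le_mul_of_nonneg_left (mul_le_mul_of_nonneg_left (hV' t ht)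
        (mul_nonneg zero_le_two (hV t ht))) hw
    have hYmin : min κ l * Y t ≤ κ * Y t :=
      mul_le_mul_of_nonneg_right (min_le_left _ _) (hY t ht)
    have hVmin : min κ l * (C / l * V t ^ 2) ≤ l * (C / l * V t ^ 2) :=
      mul_le_mul_of_nonneg_right (min_le_right _ _) (mul_nonneg hw (sq_nonneg _))
    calc Y' t + C / l * (2 * V t * V' t)
        ≤ -κ * Y t + C * V t ^ 2 + C / l * (2 * V t * (-l * V t)) := add_le_add (hY' t ht) hVV'
      _ = -(κ * Y t) - l * (C / l * V t ^ 2) := by linear_combination -V t ^ 2 * hlC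
      _ ≤ -min κ l * (Y t + C / l * V t ^ 2) := by linarith

section Poincare

variable {f f' : ℝ → ℝ} {a b : ℝ}

theorem sq_intervalIntegral_le (hab : a ≤ b) (hf : ContinuousOn f (Icc a b)) :
    (∫ x in a..b, f x) ^ 2 ≤ (b - a) * ∫ x in a..b, f x ^ 2 := by
  rcases hab.eq_or_lt with rfl | hlt
  · simp
  have hlen : 0 < b - a := sub_pos.2 hlt
  have hint : IntervalIntegrable f volume a b := hf.intervalIntegrable_of_Icc hab
  have hint_sq : IntervalIntegrable (fun x => f x ^ 2) volume a b :=
    (hf.pow 2).intervalIntegrable_of_Icc hab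
  have deviation_nonneg : ∀ c : ℝ,
      0 ≤ (∫ x in a..b, f x ^ 2) - 2 * c * (∫ x in a..b, f x) + (b - a) * c ^ 2 := by
    intro c
    calc 0 ≤ ∫ x in a..b, (f x - c) ^ 2 :=
          intervalIntegral.integral_nonneg hab fun x _ => sq_nonneg _
      _ = ∫ x in a..b, (f x ^ 2 - 2 * c * f x + c ^ 2) :=
          intervalIntegral.integral_congr fun x _ => by ring
      _ = _ := by
          rw [intervalIntegral.integral_add (hint_sq.sub (hint.const_mul _))
            intervalIntegrable_const, intervalIntegral.integral_sub hint_sq (hint.const_mul _),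
            intervalIntegral.integral_const_mul, intervalIntegral.integral_const, smul_eq_mul]
  have hmean := mul_nonneg hlen.le (deviation_nonneg ((∫ x in a..b, f x) / (b - a)))
  field_simp at hmean
  nlinarith

theorem sq_le_mul_integral_sq_deriv (hf : ContinuousOn f (Icc a b))
    (hf' : ContinuousOn f' (Icc a b)) (hd : ∀ x ∈ Ioo a b, HasDerivAt f (f' x) x) (hb : f b = 0)
    {x : ℝ} (hx : x ∈ Icc a b) : f x ^ 2 ≤ (b - a) * ∫ y in a..b, f' y ^ 2 := by
  have hsub : Icc x b ⊆ Icc a b := Icc_subset_Icc_left hx.1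
  have hint : IntervalIntegrable (fun y => f' y ^ 2) volume a b :=
    (hf'.pow 2).intervalIntegrable_of_Icc (hx.1.trans hx.2)
  calc f x ^ 2 = (∫ y in x..b, f' y) ^ 2 := by
        rw [intervalIntegral.integral_eq_sub_of_hasDerivAt_of_le hx.2 (hf.mono hsub)
          (fun y hy => hd y ⟨hx.1.trans_lt hy.1, hy.2⟩)
          ((hf'.mono hsub).intervalIntegrable_of_Icc hx.2), hb, zero_sub, neg_sq]
    _ ≤ (b - x) * ∫ y in x..b, f' y ^ 2 := sq_intervalIntegral_le hx.2 (hf'.mono hsub)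
    _ ≤ (b - a) * ∫ y in a..b, f' y ^ 2 :=
        mul_le_mul (sub_le_sub_left hx.1 b)
          (intervalIntegral.integral_mono_interval hx.1 hx.2 le_rfl
            (ae_of_all _ fun y => sq_nonneg _) hint)
          (intervalIntegral.integral_nonneg hx.2 fun y _ => sq_nonneg _)
          (sub_nonneg.2 (hx.1.trans hx.2))

theorem integral_sq_le_mul_integral_sq_deriv (hab : a ≤ b) (hf : ContinuousOn f (Icc a b))
    (hf' : ContinuousOn f' (Icc a b)) (hd : ∀ x ∈ Ioo a b, HasDerivAt f (f' x) x)
    (hb : f b = 0) : (∫ x in a..b, f x ^ 2) ≤ (b - a) ^ 2 * ∫ x in a..b, f' x ^ 2 := by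
  have hmono := intervalIntegral.integral_mono_on hab ((hf.pow 2).intervalIntegrable_of_Icc hab)
    (intervalIntegrable_const (μ := volume)) fun x hx => sq_le_mul_integral_sq_deriv hf hf' hd hb hx
  rw [intervalIntegral.integral_const, smul_eq_mul] at hmono
  rw [pow_two (b - a), mul_assoc]
  exact hmono

end Poincare

/-- The part of the liquid phase, in the `(x, t)` plane, which lies over the set of times `K`. -/
def liquidRegion (s : ℝ → ℝ) (K : Set ℝ) : Set (ℝ × ℝ) :=
  {p | p.2 ∈ K ∧ 0 ≤ p.1 ∧ p.1 ≤ s p.2}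

theorem isClosed_liquidRegion {s : ℝ → ℝ} {K : Set ℝ} (hK : IsClosed K)
    (hs : ContinuousOn s K) : IsClosed (liquidRegion s K) := by
  have hstrip : IsClosed {p : ℝ × ℝ | p.2 ∈ K ∧ 0 ≤ p.1} :=
    (hK.preimage continuous_snd).inter (isClosed_Ici.preimage continuous_fst)
  have hclosed := hstrip.isClosed_le continuousOn_fst
    (hs.comp continuousOn_snd fun p hp => hp.1)
  simpa only [liquidRegion, mem_ofPred_eq, and_assoc, Function.comp_apply] using hclosed

theorem ordConnected_fiber_liquidRegion (s : ℝ → ℝ) (K : Set ℝ) (t : ℝ) :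
    {x | (x, t) ∈ liquidRegion s K}.OrdConnected :=
  ⟨fun _ hx _ hy _ hz => ⟨hx.1, hx.2.1.trans hz.1, hz.2.trans hy.2.2⟩⟩

theorem Icc_subset_setOf_coe_lt {a c : ℝ} {b : EReal} (hc : (c : EReal) < b) :
    Icc a c ⊆ {t : ℝ | a ≤ t ∧ (t : EReal) < b} := fun _ ht =>
  ⟨ht.1, (EReal.coe_le_coe_iff.2 ht.2).trans_lt hc⟩

theorem eventually_coe_lt {b : EReal} {t : ℝ} (ht : (t : EReal) < b) :
    ∀ᶠ r : ℝ in 𝓝 t, (r : EReal) < b :=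
  continuous_coe_real_ereal.continuousAt.eventually_lt_const ht

/-- The rate of change of `∫ φ(T - Tm)` over `[ε, s(t) - ε]`, where `φ₁ = φ'` and `φ₂ = φ''`:
boundary fluxes, dissipation, and transport through the moving end point. -/
noncomputable def truncatedEnergyRate (P : StefanParams) (T : ℝ → ℝ → ℝ) (s φ φ₁ φ₂ : ℝ → ℝ)
    (ε t : ℝ) : ℝ :=
  P.α * (φ₁ (T (s t - ε) t - P.Tm) * spaceDeriv T s (s t - ε) t
      - φ₁ (T ε t - P.Tm) * spaceDeriv T s ε t
      - ∫ x in ε..s t - ε, φ₂ (T x t - P.Tm) * spaceDeriv T s x t ^ 2)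
    - P.β * spaceDeriv T s (s t) t * φ (T (s t - ε) t - P.Tm)

namespace IsStefanSolution

variable {P : StefanParams} {T : ℝ → ℝ → ℝ} {s q U : ℝ → ℝ} {a : ℝ} {b : EReal}

theorem hasDerivAt_space (h : IsStefanSolution P T s q U a b) {x t : ℝ} (ht : a < t)
    (htb : (t : EReal) < b) (hx : 0 < x) (hxs : x < s t) :
    HasDerivAt (fun y => T y t) (spaceDeriv T s x t) x :=
  ((h.T_diff_x t ht htb x ⟨hx.le, hxs.le⟩).hasDerivWithinAt).hasDerivAt (Icc_mem_nhds hx hxs)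

theorem continuousOn_temperature_sub (h : IsStefanSolution P T s q U a b) {t : ℝ} (ht : a ≤ t)
    (htb : (t : EReal) < b) : ContinuousOn (fun x => T x t - P.Tm) (Icc 0 (s t)) :=
  (h.T_cont.comp (f := fun x => (x, t)) (by fun_prop)
    fun _ hx => ⟨ht, htb, hx.1, hx.2⟩).sub continuousOn_const

theorem continuousOn_spaceDeriv (h : IsStefanSolution P T s q U a b) {t : ℝ} (ht : a < t)
    (htb : (t : EReal) < b) : ContinuousOn (fun x => spaceDeriv T s x t) (Icc 0 (s t)) :=
  h.Tx_cont.comp (f := fun x => (x, t)) (by fun_prop) fun _ hx => ⟨ht, htb, hx.1, hx.2⟩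

theorem continuousOn_comp_temperature (h : IsStefanSolution P T s q U a b) {φ : ℝ → ℝ}
    (hφ : Continuous φ) {c : ℝ} (hc : (c : EReal) < b) :
    ContinuousOn (fun p : ℝ × ℝ => φ (T p.1 p.2 - P.Tm)) (liquidRegion s (Icc a c)) := by
  have hsub := Icc_subset_setOf_coe_lt (a := a) hc
  exact hφ.comp_continuousOn ((h.T_cont.mono fun p hp =>
    ⟨(hsub hp.1).1, (hsub hp.1).2, hp.2⟩).sub continuousOn_const)

theorem continuousOn_integral (h : IsStefanSolution P T s q U a b) {φ : ℝ → ℝ}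
    (hφ : Continuous φ) {c : ℝ} (hc : (c : EReal) < b) :
    ContinuousOn (fun r => ∫ x in (0 : ℝ)..s r, φ (T x r - P.Tm)) (Icc a c) := by
  have hsub := Icc_subset_setOf_coe_lt (a := a) hc
  have hs := h.s_cont.mono hsub
  have hs₀ : ∀ r ∈ Icc a c, 0 ≤ s r := fun r hr => (h.s_pos r (hsub hr).1 (hsub hr).2).le
  exact continuousOn_integral_fiber (f := fun x r => φ (T x r - P.Tm))
    (isClosed_liquidRegion isClosed_Icc hs) (ordConnected_fiber_liquidRegion _ _)
    (h.continuousOn_comp_temperature hφ hc) continuousOn_const hs continuousOn_id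
    (fun r hr => ⟨hr, le_rfl, hs₀ r hr⟩) (fun r hr => ⟨hr, hs₀ r hr, le_rfl⟩)

theorem integral_mul_deriv_spaceDeriv (h : IsStefanSolution P T s q U a b) {φ₁ φ₂ : ℝ → ℝ}
    (hφ₁ : ∀ x, HasDerivAt φ₁ (φ₂ x) x) (hφ₂ : Continuous φ₂) {c d t : ℝ} (ht : a < t)
    (htb : (t : EReal) < b) (hc : 0 < c) (hcd : c ≤ d) (hd : d < s t) :
    (∫ x in c..d, φ₁ (T x t - P.Tm) * deriv (fun y => spaceDeriv T s y t) x) =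
      φ₁ (T d t - P.Tm) * spaceDeriv T s d t - φ₁ (T c t - P.Tm) * spaceDeriv T s c t
        - ∫ x in c..d, φ₂ (T x t - P.Tm) * spaceDeriv T s x t ^ 2 := by
  have interior : ∀ x ∈ uIcc c d, 0 < x ∧ x < s t := fun x hx => by
    rw [uIcc_of_le hcd] at hx
    exact ⟨hc.trans_le hx.1, hx.2.trans_lt hd⟩
  have hsub : uIcc c d ⊆ Icc 0 (s t) := fun x hx =>
    ⟨(interior x hx).1.le, (interior x hx).2.le⟩
  have hw := (h.continuousOn_spaceDeriv ht htb).mono hsub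
  have hφ₂T := hφ₂.comp_continuousOn ((h.continuousOn_temperature_sub ht.le htb).mono hsub)
  have hxx : ContinuousOn (fun x => deriv (fun y => spaceDeriv T s y t) x) (uIcc c d) :=
    h.Txx_cont.comp (f := fun x => (x, t)) (by fun_prop) fun x hx => ⟨ht, htb, interior x hx⟩
  have hparts := intervalIntegral.integral_mul_deriv_eq_deriv_mul
    (u := fun x => φ₁ (T x t - P.Tm)) (u' := fun x => φ₂ (T x t - P.Tm) * spaceDeriv T s x t)
    (v := fun x => spaceDeriv T s x t)
    (fun x hx => (hφ₁ _).comp x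
      ((h.hasDerivAt_space ht htb (interior x hx).1 (interior x hx).2).sub_const P.Tm))
    (fun x hx => (h.T_diff_xx t x ht htb (interior x hx).1 (interior x hx).2).hasDerivAt)
    (hφ₂T.mul hw).intervalIntegrable hxx.intervalIntegrable
  simpa only [pow_two, mul_assoc] using hparts

theorem hasDerivAt_truncated_integral (h : IsStefanSolution P T s q U a b) {φ φ₁ φ₂ : ℝ → ℝ}
    (hφ : ∀ x, HasDerivAt φ (φ₁ x) x) (hφ₁ : ∀ x, HasDerivAt φ₁ (φ₂ x) x) (hφ₂ : Continuous φ₂)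
    {ε t : ℝ} (ht : a < t) (htb : (t : EReal) < b) (hε : 0 < ε) (hεs : 2 * ε < s t) :
    HasDerivAt (fun r => ∫ x in ε..s r - ε, φ (T x r - P.Tm))
      (truncatedEnergyRate P T s φ φ₁ φ₂ ε t) t := by
  have hφc : Continuous φ := continuous_iff_continuousAt.2 fun x => (hφ x).continuousAt
  have hφ₁c : Continuous φ₁ := continuous_iff_continuousAt.2 fun x => (hφ₁ x).continuousAt
  let I : Set ℝ := Ioo 0 (s t - ε / 2)
  let J : Set ℝ := {r | a < r ∧ (r : EReal) < b ∧ s t - ε / 2 < s r}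
  have hJ : J ∈ 𝓝 t := (eventually_gt_nhds ht).and ((eventually_coe_lt htb).and
    ((h.interface t ht htb).continuousAt.eventually_const_lt (by linarith)))
  have hT : ContinuousOn (fun p : ℝ × ℝ => T p.1 p.2 - P.Tm) (I ×ˢ J) :=
    (h.T_cont.mono fun p hp => ⟨hp.2.1.le, hp.2.2.1, hp.1.1.le,
      (hp.1.2.trans hp.2.2.2).le⟩).sub continuousOn_const
  have hTt : ContinuousOn (fun p : ℝ × ℝ => deriv (fun r => T p.1 r) p.2) (I ×ˢ J) :=
    h.Tt_cont.mono fun p hp => ⟨hp.2.1, hp.2.2.1, hp.1.1, hp.1.2.trans hp.2.2.2⟩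
  have leibniz := hasDerivAt_integral_of_moving_endpoint (f := fun x r => φ (T x r - P.Tm))
    (f' := fun x r => φ₁ (T x r - P.Tm) * deriv (fun r => T x r) r) (g := fun r => s r - ε)
    (c := ε) (I := I) isOpen_Ioo ordConnected_Ioo ⟨hε, by linarith⟩
    ⟨by linarith, by linarith⟩ hJ (hφc.comp_continuousOn hT) ((hφ₁c.comp_continuousOn hT).mul hTt)
    (fun x hx r hr => (hφ _).comp r ((h.T_diff_t r x hr.1 hr.2.1 hx.1
      (hx.2.trans hr.2.2)).hasDerivAt.sub_const P.Tm)) ((h.interface t ht htb).sub_const ε)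
  refine leibniz.congr_deriv ?_
  have hle : ε ≤ s t - ε := by linarith
  have heat : (∫ x in ε..s t - ε, φ₁ (T x t - P.Tm) * deriv (fun r => T x r) t) =
      P.α * ∫ x in ε..s t - ε, φ₁ (T x t - P.Tm) * deriv (fun y => spaceDeriv T s y t) x := by
    rw [← intervalIntegral.integral_const_mul]
    refine intervalIntegral.integral_congr fun x hx => ?_
    rw [uIcc_of_le hle] at hx
    simp only [h.heat t x ht htb (hε.trans_le hx.1) (hx.2.trans_lt (by linarith))]
    ring
  rw [heat, h.integral_mul_deriv_spaceDeriv hφ₁ hφ₂ ht htb hε hle (by linarith),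
    truncatedEnergyRate, smul_eq_mul]
  ring

theorem continuousOn_truncatedEnergyRate (h : IsStefanSolution P T s q U a b) {φ φ₁ φ₂ : ℝ → ℝ}
    (hφ : Continuous φ) (hφ₁ : Continuous φ₁) (hφ₂ : Continuous φ₂) {m t₁ t₂ : ℝ}
    (ht₁ : a < t₁) (ht₂ : (t₂ : EReal) < b) (hm : ∀ r ∈ Icc t₁ t₂, 2 * m ≤ s r) :
    ContinuousOn (fun p : ℝ × ℝ => truncatedEnergyRate P T s φ φ₁ φ₂ p.1 p.2)
      (Icc 0 m ×ˢ Icc t₁ t₂) := by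
  have hw : ContinuousOn (fun p : ℝ × ℝ => spaceDeriv T s p.1 p.2)
      (liquidRegion s (Icc t₁ t₂)) := h.Tx_cont.mono fun p hp =>
    ⟨ht₁.trans_le hp.1.1, (Icc_subset_setOf_coe_lt ht₂ hp.1).2, hp.2⟩
  have hT : ∀ {ψ : ℝ → ℝ}, Continuous ψ →
      ContinuousOn (fun p : ℝ × ℝ => ψ (T p.1 p.2 - P.Tm)) (liquidRegion s (Icc t₁ t₂)) :=
    fun hψ => (h.continuousOn_comp_temperature hψ ht₂).mono fun p hp =>
      ⟨Icc_subset_Icc_left ht₁.le hp.1, hp.2⟩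
  have hs : ContinuousOn s (Icc t₁ t₂) :=
    h.s_cont.mono ((Icc_subset_Icc_left ht₁.le).trans (Icc_subset_setOf_coe_lt ht₂))
  have hst : ContinuousOn (fun p : ℝ × ℝ => s p.2) (Icc 0 m ×ˢ Icc t₁ t₂) :=
    hs.comp continuousOn_snd fun p hp => hp.2
  have hleft : ∀ p ∈ Icc 0 m ×ˢ Icc t₁ t₂, (p.1, p.2) ∈ liquidRegion s (Icc t₁ t₂) :=
    fun p hp => ⟨hp.2, hp.1.1, by linarith [hm _ hp.2, hp.1.1, hp.1.2]⟩
  have hright : ∀ p ∈ Icc 0 m ×ˢ Icc t₁ t₂, (s p.2 - p.1, p.2) ∈ liquidRegion s (Icc t₁ t₂) :=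
    fun p hp => ⟨hp.2, by linarith [hm _ hp.2, hp.1.1, hp.1.2], by linarith [hp.1.1]⟩
  have hfront : ∀ p ∈ Icc 0 m ×ˢ Icc t₁ t₂, (s p.2, p.2) ∈ liquidRegion s (Icc t₁ t₂) :=
    fun p hp => ⟨hp.2, by linarith [hm _ hp.2, hp.1.1, hp.1.2], le_rfl⟩
  have left_cont : ContinuousOn (fun p : ℝ × ℝ => (p.1, p.2)) (Icc 0 m ×ˢ Icc t₁ t₂) :=
    continuousOn_id
  have right_cont := (hst.sub continuousOn_fst).prodMk continuousOn_snd
  have front_cont := hst.prodMk continuousOn_snd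
  have dissipation := continuousOn_integral_fiber
    (f := fun x r => φ₂ (T x r - P.Tm) * spaceDeriv T s x r ^ 2)
    (isClosed_liquidRegion isClosed_Icc hs) (ordConnected_fiber_liquidRegion _ _)
    ((hT hφ₂).mul (hw.pow 2)) continuousOn_fst (hst.sub continuousOn_fst) continuousOn_snd
    hleft hright
  exact ((((((hT hφ₁).mul hw).comp right_cont hright).sub
    (((hT hφ₁).mul hw).comp left_cont hleft)).sub dissipation).const_mul P.α).sub
    (((hw.comp front_cont hfront).const_mul P.β).mul ((hT hφ).comp right_cont hright))

theorem tendsto_truncated_integral (h : IsStefanSolution P T s q U a b) {φ : ℝ → ℝ}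
    (hφ : Continuous φ) {t : ℝ} (ht : a ≤ t) (htb : (t : EReal) < b) :
    Tendsto (fun ε => ∫ x in ε..s t - ε, φ (T x t - P.Tm)) (𝓝[>] 0)
      (𝓝 (∫ x in (0 : ℝ)..s t - 0, φ (T x t - P.Tm))) := by
  have hs := h.s_pos t ht htb
  have hmem : ∀ ε ∈ Icc 0 (s t),
      (ε, t) ∈ liquidRegion s {t} ∧ (s t - ε, t) ∈ liquidRegion s {t} := fun ε hε =>
    ⟨⟨rfl, hε.1, hε.2⟩, rfl, sub_nonneg.2 hε.2, sub_le_self _ hε.1⟩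
  have hcont : ContinuousOn (fun ε => ∫ x in ε..s t - ε, φ (T x t - P.Tm)) (Icc 0 (s t)) :=
    continuousOn_integral_fiber (f := fun x r => φ (T x r - P.Tm)) (r := fun _ => t)
      (isClosed_liquidRegion isClosed_singleton (continuousOn_singleton s t))
      (ordConnected_fiber_liquidRegion _ _)
      ((h.continuousOn_comp_temperature hφ htb).mono fun p hp =>
        ⟨by rw [show p.2 = t from hp.1]; exact right_mem_Icc.2 ht, hp.2⟩)
      continuousOn_id (by fun_prop) continuousOn_const (fun ε hε => (hmem ε hε).1)
      fun ε hε => (hmem ε hε).2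
  rw [← nhdsWithin_Ioo_eq_nhdsGT hs]
  exact (hcont 0 (left_mem_Icc.2 hs.le)).mono Ioo_subset_Icc_self

theorem hasDerivAt_integral (h : IsStefanSolution P T s q U a b) {φ φ₁ φ₂ : ℝ → ℝ}
    (hφ : ∀ x, HasDerivAt φ (φ₁ x) x) (hφ₁ : ∀ x, HasDerivAt φ₁ (φ₂ x) x) (hφ₂ : Continuous φ₂)
    (hφ0 : φ 0 = 0) {t : ℝ} (ht : a < t) (htb : (t : EReal) < b) :
    HasDerivAt (fun r => ∫ x in (0 : ℝ)..s r, φ (T x r - P.Tm))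
      (P.α * (φ₁ 0 * spaceDeriv T s (s t) t - φ₁ (T 0 t - P.Tm) * spaceDeriv T s 0 t
        - ∫ x in (0 : ℝ)..s t, φ₂ (T x t - P.Tm) * spaceDeriv T s x t ^ 2)) t := by
  have hφc : Continuous φ := continuous_iff_continuousAt.2 fun x => (hφ x).continuousAt
  have hφ₁c : Continuous φ₁ := continuous_iff_continuousAt.2 fun x => (hφ₁ x).continuousAt
  have hs := h.s_pos t ht.le htb
  have hnear : ∀ᶠ r in 𝓝 t, a < r ∧ (r : EReal) < b ∧ s t / 2 < s r :=
    (eventually_gt_nhds ht).and ((eventually_coe_lt htb).and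
      ((h.interface t ht htb).continuousAt.eventually_const_lt (half_lt_self hs)))
  obtain ⟨η, hη, hball⟩ := Metric.nhds_basis_closedBall.eventually_iff.1 hnear
  rw [Real.closedBall_eq_Icc] at hball
  have hle : t - η ≤ t + η := by linarith
  have hIcc : Ioo (t - η) (t + η) ⊆ Icc (t - η) (t + η) := Ioo_subset_Icc_self
  have hlimit := hasDerivAt_of_tendsto_of_continuousOn_deriv
    (F := fun ε r => ∫ x in ε..s r - ε, φ (T x r - P.Tm))
    (F' := truncatedEnergyRate P T s φ φ₁ φ₂) (m := s t / 4) (J := Ioo (t - η) (t + η)) (t := t)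
    (by positivity) isOpen_Ioo ⟨by linarith, by linarith⟩
    ((h.continuousOn_truncatedEnergyRate hφc hφ₁c hφ₂
      (hball (left_mem_Icc.2 hle)).1 (hball (right_mem_Icc.2 hle)).2.1
      fun r hr => by linarith [(hball hr).2.2]).mono (prod_mono Ico_subset_Icc_self hIcc))
    (fun ε hε r hr => h.hasDerivAt_truncated_integral hφ hφ₁ hφ₂ (hball (hIcc hr)).1
      (hball (hIcc hr)).2.1 hε.1 (by linarith [(hball (hIcc hr)).2.2, hε.2]))
    fun r hr => h.tendsto_truncated_integral hφc (hball (hIcc hr)).1.le (hball (hIcc hr)).2.1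
  simpa only [truncatedEnergyRate, sub_zero, h.melt t ht htb, sub_self, hφ0, mul_zero] using hlimit

end IsStefanSolution

theorem nonneg_of_integral_min_zero_pow_nonpos {f : ℝ → ℝ} {a b : ℝ} (hab : a < b)
    (hf : ContinuousOn f (Icc a b)) (hint : (∫ x in a..b, min (f x) 0 ^ 4) ≤ 0) :
    ∀ x ∈ Icc a b, 0 ≤ f x := by
  intro x hx
  by_contra! hneg
  refine hint.not_gt (intervalIntegral.integral_pos hab
    ((show Continuous fun y : ℝ => min y 0 ^ 4 by fun_prop).comp_continuousOn hf)
    (fun _ _ => by positivity) ⟨x, hx, ?_⟩)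
  rw [min_eq_left hneg.le]
  exact Even.pow_pos (by decide) hneg.ne

namespace IsStefanSolution

variable {P : StefanParams} {T : ℝ → ℝ → ℝ} {s q U : ℝ → ℝ} {a : ℝ} {b : EReal}

theorem hasDerivAt_energyDeficit (h : IsStefanSolution P T s q U a b) (hk : P.k ≠ 0)
    (hα : P.α ≠ 0) (hβ : P.β ≠ 0) (sr : ℝ) {t : ℝ} (ht : a < t) (htb : (t : EReal) < b) :
    HasDerivAt (energyDeficit P sr T s) (-q t) t := by
  have henergy := h.hasDerivAt_integral (φ := fun x => x) (φ₁ := fun _ => 1) (φ₂ := fun _ => 0)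
    (fun x => hasDerivAt_id x) (fun x => hasDerivAt_const x 1) continuous_const rfl ht htb
  refine (((henergy.const_mul (P.k / P.α)).add
    (((h.interface t ht htb).sub_const sr).const_mul (P.k / P.β))).neg).congr_deriv ?_
  rw [← h.flux t ht htb]
  simp only [zero_mul, intervalIntegral.integral_zero]
  field_simp
  ring

theorem continuousOn_energyDeficit (h : IsStefanSolution P T s q U a b) (sr : ℝ) {c : ℝ}
    (hc : (c : EReal) < b) : ContinuousOn (energyDeficit P sr T s) (Icc a c) :=
  (((h.continuousOn_integral continuous_id hc).const_mul _).add
    (((h.s_cont.mono (Icc_subset_setOf_coe_lt hc)).sub continuousOn_const).const_mul _)).neg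

theorem integral_min_zero_pow_le (h : IsStefanSolution P T s q U a b) (hk : 0 < P.k)
    (hα : 0 < P.α) {c : ℝ} (hac : a ≤ c) (hc : (c : EReal) < b)
    (hq : ∀ t ∈ Ioo a c, 0 ≤ q t) :
    (∫ x in (0 : ℝ)..s c, min (T x c - P.Tm) 0 ^ 4) ≤
      ∫ x in (0 : ℝ)..s a, min (T x a - P.Tm) 0 ^ 4 := by
  have hlt : ∀ t ∈ Ioo a c, (t : EReal) < b := fun t ht =>
    (Icc_subset_setOf_coe_lt hc (Ioo_subset_Icc_self ht)).2
  have hderiv := fun t (ht : t ∈ Ioo a c) =>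
    h.hasDerivAt_integral (φ := fun x => min x 0 ^ 4)
      (φ₁ := fun x => 4 * min x 0 ^ 3) (φ₂ := fun x => 4 * (3 * min x 0 ^ 2))
      (fun x => (hasDerivAt_min_zero_pow 2 x).congr_deriv (by norm_num))
      (fun x => ((hasDerivAt_min_zero_pow 1 x).const_mul 4).congr_deriv (by norm_num))
      (by fun_prop) (by simp) ht.1 (hlt t ht)
  refine le_of_rightDeriv_nonpos hac
    (h.continuousOn_integral (φ := fun x => min x 0 ^ 4) (by fun_prop) hc)
    (fun t ht => (hderiv t ht).hasDerivWithinAt) fun t ht => ?_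
  have dissipation : 0 ≤ ∫ x in (0 : ℝ)..s t, 4 * (3 * min (T x t - P.Tm) 0 ^ 2) *
      spaceDeriv T s x t ^ 2 :=
    intervalIntegral.integral_nonneg (h.s_pos t ht.1.le (hlt t ht)).le fun x _ => by positivity
  have flux_in : spaceDeriv T s 0 t ≤ 0 := by
    have := h.flux t ht.1 (hlt t ht)
    nlinarith [hq t ht]
  have cold : min (T 0 t - P.Tm) 0 ^ 3 ≤ 0 :=
    Odd.pow_nonpos (by decide) (min_le_right _ _)
  have boundary := mul_nonneg_of_nonpos_of_nonpos cold flux_in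
  refine mul_nonpos_of_nonneg_of_nonpos hα.le ?_
  simp only [min_self]
  linarith

theorem melting_le (h : IsStefanSolution P T s q U a b) (hk : 0 < P.k) (hα : 0 < P.α)
    {c : ℝ} (hac : a ≤ c) (hc : (c : EReal) < b) (hq : ∀ t ∈ Ioo a c, 0 ≤ q t)
    (h0 : ∀ x ∈ Ioc 0 (s a), P.Tm ≤ T x a) : ∀ x ∈ Icc 0 (s c), P.Tm ≤ T x c := by
  have hsa := h.s_pos a le_rfl ((EReal.coe_le_coe_iff.2 hac).trans_lt hc)
  have initially_zero : (∫ x in (0 : ℝ)..s a, min (T x a - P.Tm) 0 ^ 4) = 0 :=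
    intervalIntegral.integral_zero_ae (ae_of_all _ fun x hx => by
      rw [uIoc_of_le hsa.le] at hx
      rw [min_eq_right (sub_nonneg.2 (h0 x hx)), zero_pow four_ne_zero])
  intro x hx
  exact sub_nonneg.1 (nonneg_of_integral_min_zero_pow_nonpos (h.s_pos c hac hc)
    (h.continuousOn_temperature_sub hac hc)
    ((h.integral_min_zero_pow_le hk hα hac hc hq).trans_eq initially_zero) x hx)

theorem restrict (h : IsStefanSolution P T s q U a b) {U' : ℝ → ℝ} {a' : ℝ} {b' : EReal}
    (ha : a ≤ a') (hb : b' ≤ b) (hU : ∀ t : ℝ, a' ≤ t → (t : EReal) < b' → U t = U' t) :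
    IsStefanSolution P T s q U' a' b' where
  s_pos t h1 h2 := h.s_pos t (ha.trans h1) (h2.trans_le hb)
  s_cont := h.s_cont.mono fun _ ht => ⟨ha.trans ht.1, ht.2.trans_le hb⟩
  T_cont := h.T_cont.mono fun _ ht => ⟨ha.trans ht.1, ht.2.1.trans_le hb, ht.2.2⟩
  T_diff_x t h1 h2 := h.T_diff_x t (ha.trans_lt h1) (h2.trans_le hb)
  Tx_cont := h.Tx_cont.mono fun _ ht => ⟨ha.trans_lt ht.1, ht.2.1.trans_le hb, ht.2.2⟩
  T_diff_xx t x h1 h2 := h.T_diff_xx t x (ha.trans_lt h1) (h2.trans_le hb)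
  T_diff_t t x h1 h2 := h.T_diff_t t x (ha.trans_lt h1) (h2.trans_le hb)
  Tt_cont := h.Tt_cont.mono fun _ ht => ⟨ha.trans_lt ht.1, ht.2.1.trans_le hb, ht.2.2⟩
  Txx_cont := h.Txx_cont.mono fun _ ht => ⟨ha.trans_lt ht.1, ht.2.1.trans_le hb, ht.2.2⟩
  heat t x h1 h2 := h.heat t x (ha.trans_lt h1) (h2.trans_le hb)
  flux t h1 h2 := h.flux t (ha.trans_lt h1) (h2.trans_le hb)
  melt t h1 h2 := h.melt t (ha.trans_lt h1) (h2.trans_le hb)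
  interface t h1 h2 := h.interface t (ha.trans_lt h1) (h2.trans_le hb)
  q_cont := h.q_cont.mono fun _ ht => ⟨ha.trans ht.1, ht.2.trans_le hb⟩
  actuator t h1 h2 := hU t h1 h2 ▸ h.actuator t (ha.trans h1) (h2.trans_le hb)

theorem q_eq_of_const {u : ℝ} (h : IsStefanSolution P T s q (fun _ => u) a b) {t : ℝ}
    (ht : a ≤ t) (htb : (t : EReal) < b) : q t = q a + u * (t - a) := by
  have hsub := Icc_subset_setOf_coe_lt (a := a) htb
  have hdiff := sub_eq_sub_of_rightDeriv_eq (g := fun r => u * (r - a)) (f' := fun _ => u) ht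
    (h.q_cont.mono hsub) (by fun_prop)
    (fun r hr => h.actuator r hr.1.le (hsub (Ioo_subset_Icc_self hr)).2)
    (fun r _ => by simpa using (((hasDerivAt_id r).sub_const a).const_mul u).hasDerivWithinAt)
  simp only [sub_self, mul_zero, sub_zero] at hdiff
  linarith

theorem energyDeficit_eq_of_const {u : ℝ} (h : IsStefanSolution P T s q (fun _ => u) a b)
    (hk : P.k ≠ 0) (hα : P.α ≠ 0) (hβ : P.β ≠ 0) (sr : ℝ) {t : ℝ} (ht : a ≤ t)
    (htb : (t : EReal) < b) :
    energyDeficit P sr T s t =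
      energyDeficit P sr T s a - q a * (t - a) - u * (t - a) ^ 2 / 2 := by
  have hsub := Icc_subset_setOf_coe_lt (a := a) htb
  have hquad : ∀ r ∈ Ioo a t,
      HasDerivAt (fun r => -(q a * (r - a)) - u * (r - a) ^ 2 / 2) (-q r) r := fun r hr => by
    have hlin := (hasDerivAt_id r).sub_const a
    refine (((hlin.const_mul (q a)).neg).sub
      (((hlin.pow 2).const_mul u).div_const 2)).congr_deriv ?_
    rw [h.q_eq_of_const hr.1.le (hsub (Ioo_subset_Icc_self hr)).2]
    simp only [id]
    ring
  have hdiff := sub_eq_sub_of_rightDeriv_eq ht (h.continuousOn_energyDeficit sr htb) (by fun_prop)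
    (fun r hr => (h.hasDerivAt_energyDeficit hk hα hβ sr hr.1
      (hsub (Ioo_subset_Icc_self hr)).2).hasDerivWithinAt)
    (fun r hr => (hquad r hr).hasDerivWithinAt)
  simp only [sub_self, mul_zero] at hdiff
  linarith

variable {G : ETCGains} {sr : ℝ}

theorem continuousOn_barrierThree (h : IsStefanSolution P T s q U a b) {c : ℝ}
    (hc : (c : EReal) < b) : ContinuousOn (barrierThree P G sr T s q) (Icc a c) :=
  (h.q_cont.mono (Icc_subset_setOf_coe_lt hc)).neg.add
    ((h.continuousOn_energyDeficit sr hc).const_mul _)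

theorem hasDerivWithinAt_barrierThree (h : IsStefanSolution P T s q U a b) (hk : P.k ≠ 0)
    (hα : P.α ≠ 0) (hβ : P.β ≠ 0) {t : ℝ} (ht : a < t) (htb : (t : EReal) < b) :
    HasDerivWithinAt (barrierThree P G sr T s q) (-U t + G.c₁ * -q t) (Ici t) t :=
  (h.actuator t ht.le htb).neg.add
    ((h.hasDerivAt_energyDeficit hk hα hβ sr ht htb).hasDerivWithinAt.const_mul _)

theorem hasDerivAt_integral_sq (h : IsStefanSolution P T s q U a b) {t : ℝ} (ht : a < t)
    (htb : (t : EReal) < b) :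
    HasDerivAt (fun r => ∫ x in (0 : ℝ)..s r, (T x r - P.Tm) ^ 2)
      (-2 * P.α * ((T 0 t - P.Tm) * spaceDeriv T s 0 t
        + ∫ x in (0 : ℝ)..s t, spaceDeriv T s x t ^ 2)) t := by
  have henergy := h.hasDerivAt_integral (φ := fun x => x ^ 2) (φ₁ := fun x => 2 * x)
    (φ₂ := fun _ => 2) (fun x => by simpa using hasDerivAt_pow 2 x)
    (fun x => by simpa using (hasDerivAt_id x).const_mul 2) continuous_const (by simp) ht htb
  refine henergy.congr_deriv ?_
  rw [intervalIntegral.integral_const_mul]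
  ring

theorem dissipation_le (h : IsStefanSolution P T s q U a b) (hk : P.k ≠ 0)
    (hα : 0 < P.α) {t R : ℝ} (ht : a < t) (htb : (t : EReal) < b) (hsR : s t ≤ R) :
    -2 * P.α * ((T 0 t - P.Tm) * spaceDeriv T s 0 t
        + ∫ x in (0 : ℝ)..s t, spaceDeriv T s x t ^ 2) ≤
      -(P.α / R ^ 2) * (∫ x in (0 : ℝ)..s t, (T x t - P.Tm) ^ 2)
        + P.α * R / P.k ^ 2 * q t ^ 2 := by
  have hs := h.s_pos t ht.le htb
  have hR := hs.trans_le hsR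
  have hTc := h.continuousOn_temperature_sub ht.le htb
  have hwc := h.continuousOn_spaceDeriv ht htb
  have hTd : ∀ x ∈ Ioo 0 (s t), HasDerivAt (fun x => T x t - P.Tm) (spaceDeriv T s x t) x :=
    fun x hx => (h.hasDerivAt_space ht htb hx.1 hx.2).sub_const P.Tm
  have hmelt : T (s t) t - P.Tm = 0 := sub_eq_zero.2 (h.melt t ht htb)
  have trace := sq_le_mul_integral_sq_deriv hTc hwc hTd hmelt (left_mem_Icc.2 hs.le)
  have poincare := integral_sq_le_mul_integral_sq_deriv hs.le hTc hwc hTd hmelt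
  have hflux : spaceDeriv T s 0 t = -(q t / P.k) := by
    rw [← h.flux t ht htb]; field_simp
  have hD : 0 ≤ ∫ x in (0 : ℝ)..s t, spaceDeriv T s x t ^ 2 :=
    intervalIntegral.integral_nonneg hs.le fun _ _ => sq_nonneg _
  rw [sub_zero] at trace poincare
  rw [hflux]
  generalize (∫ x in (0 : ℝ)..s t, spaceDeriv T s x t ^ 2) = D at *
  generalize (∫ x in (0 : ℝ)..s t, (T x t - P.Tm) ^ 2) = Y at *
  generalize T 0 t - P.Tm = u at *
  have young : 2 * u * (q t / P.k) ≤ D + R * (q t / P.k) ^ 2 := by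
    have hu : u ^ 2 ≤ R * D := trace.trans (mul_le_mul_of_nonneg_right hsR hD)
    refine le_of_mul_le_mul_left ?_ hR
    linarith [sq_nonneg (u - R * (q t / P.k))]
  have hY : Y / R ^ 2 ≤ D := by
    rw [div_le_iff₀' (by positivity)]
    exact poincare.trans (mul_le_mul_of_nonneg_right (pow_le_pow_left₀ hs.le hsR 2) hD)
  calc -2 * P.α * (u * -(q t / P.k) + D) = P.α * (2 * u * (q t / P.k) - 2 * D) := by ring
    _ ≤ P.α * (R * (q t / P.k) ^ 2 - Y / R ^ 2) := mul_le_mul_of_nonneg_left (by linarith) hα.le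
    _ = _ := by ring

end IsStefanSolution

namespace ETCGains

variable {G : ETCGains}

theorem μ₁_pos (hc₁ : 0 < G.c₁) (hc₂ : 0 < G.c₂) (hδ₁ : 0 < G.δ₁) (hδ₂' : G.δ₂ < 1) :
    0 < G.μ₁ :=
  lt_min (mul_pos hδ₁ hc₁) (mul_pos (sub_pos.2 hδ₂') hc₂)

/-- The bounds `-δ₂ c₂ h₃ ≤ w ≤ μ₁ h₂ + δ₂ c₂ h₃` on the deviation `w = U* - U` of the nominal
from the applied input, whose violation triggers an event. -/
def AdmissibleDeviation (G : ETCGains) (w h₂ h₃ : ℝ) : Prop :=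
  -G.δ₂ * G.c₂ * h₃ ≤ w ∧ w ≤ G.μ₁ * h₂ + G.δ₂ * G.c₂ * h₃

theorem exists_dwellTime (hc₁ : 0 < G.c₁) (hc₂ : 0 < G.c₂) (hδ₁ : 0 < G.δ₁) (hδ₂ : 0 < G.δ₂)
    (hδ₂' : G.δ₂ < 1) :
    ∃ τ > 0, ∀ x y u r h₂ h₃ : ℝ, 0 ≤ x → 0 ≤ y → 0 ≤ r → r < τ → u = -G.c₁ * x + G.c₂ * y →
      h₂ = x + u * r → h₃ = y - u * r - G.c₁ * (x * r + u * r ^ 2 / 2) →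
      G.AdmissibleDeviation (-G.c₁ * h₂ + G.c₂ * h₃ - u) h₂ h₃ := by
  have hμ : 0 < G.μ₁ := μ₁_pos hc₁ hc₂ hδ₁ hδ₂'
  have : 0 < 1 - G.δ₂ := sub_pos.2 hδ₂'
  -- The polynomials are the coefficients of `y` in the lower and of `x` in the upper bound.
  have lower_coeff : ∀ᶠ r in 𝓝 (0 : ℝ), 0 < (1 + G.δ₂) * G.c₂ *
      (1 - G.c₂ * r - G.c₁ * G.c₂ * r ^ 2 / 2) - G.c₁ * G.c₂ * r - G.c₂ :=
    (Continuous.tendsto' (by fun_prop) 0 (G.δ₂ * G.c₂) (by ring)).eventually_const_lt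
      (mul_pos hδ₂ hc₂)
  have upper_coeff : ∀ᶠ r in 𝓝 (0 : ℝ), 0 < G.μ₁ * (1 - G.c₁ * r) - G.c₁ ^ 2 * r -
      (1 - G.δ₂) * G.c₂ * (G.c₁ ^ 2 * r ^ 2 / 2) :=
    (Continuous.tendsto' (by fun_prop) 0 G.μ₁ (by ring)).eventually_const_lt hμ
  obtain ⟨τ, hτ, hcoeff⟩ := Metric.eventually_nhds_iff.1 (lower_coeff.and upper_coeff)
  refine ⟨τ, hτ, ?_⟩
  rintro x y u r h₂ h₃ hx hy hr hrτ rfl rfl rfl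
  obtain ⟨hlower, hupper⟩ := hcoeff (by simpa [abs_of_nonneg hr] using hrτ : dist r 0 < τ)
  constructor
  · have hxterm : 0 ≤ x * (G.c₁ ^ 2 * r + (1 + G.δ₂) * G.c₂ * (G.c₁ ^ 2 * r ^ 2 / 2)) := by
      positivity
    linear_combination hxterm + mul_nonneg hy hlower.le
  · have hyterm : 0 ≤ y * ((G.μ₁ + G.c₁) * G.c₂ * r + G.δ₂ * G.c₂ +
        (1 - G.δ₂) * G.c₂ * (G.c₂ * r + G.c₁ * G.c₂ * r ^ 2 / 2)) := by positivity
    linear_combination hyterm + mul_nonneg hx hupper.le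

end ETCGains

section DwellTime

variable {P : StefanParams} {G : ETCGains} {sr : ℝ} {T : ℝ → ℝ → ℝ} {s q U : ℝ → ℝ}

theorem admissibleDeviation_of_not_triggered {a t : ℝ} (h : ¬ Triggered P G sr T s q a t) :
    G.AdmissibleDeviation (nominalControl P G sr T s q t - nominalControl P G sr T s q a)
      (q t) (barrierThree P G sr T s q t) := by
  simpa only [Triggered, ETCGains.AdmissibleDeviation, not_or, gt_iff_lt, not_lt] using h

theorem energyDeficit_congr {T' : ℝ → ℝ → ℝ} {s' : ℝ → ℝ} {a : ℝ} (hs0 : 0 ≤ s a)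
    (hs : s' a = s a) (hT : ∀ x ∈ Icc 0 (s a), T' x a = T x a) :
    energyDeficit P sr T' s' a = energyDeficit P sr T s a := by
  simp only [energyDeficit, hs]
  rw [intervalIntegral.integral_congr fun x hx => by
    rw [hT x (uIcc_of_le hs0 ▸ hx)]]

theorem exists_add_le_of_mem_triggerSet (hk : P.k ≠ 0) (hα : P.α ≠ 0) (hβ : P.β ≠ 0)
    (hc₁ : 0 < G.c₁) (hc₂ : 0 < G.c₂) (hδ₁ : 0 < G.δ₁) (hδ₂ : 0 < G.δ₂) (hδ₂' : G.δ₂ < 1)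
    (sr : ℝ) :
    ∃ τ > 0, ∀ (T : ℝ → ℝ → ℝ) (s q : ℝ → ℝ) (a : ℝ), 0 ≤ s a → 0 ≤ q a →
      0 ≤ barrierThree P G sr T s q a → ∀ t ∈ triggerSet P G sr T s q a, a + τ ≤ t := by
  obtain ⟨τ, hτ, hdwell⟩ := ETCGains.exists_dwellTime hc₁ hc₂ hδ₁ hδ₂ hδ₂'
  refine ⟨τ, hτ, ?_⟩
  rintro T s q a hs hqa hba t ⟨hat, T', s', q', b, htb, hsol, hs', hq', hT', htrig⟩
  by_contra! hlt
  have htb' : (t : EReal) < b := EReal.coe_lt_coe_iff.2 htb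
  have same_deficit := energyDeficit_congr (P := P) (sr := sr) hs hs' hT'
  have same_control : nominalControl P G sr T' s' q' a = nominalControl P G sr T s q a := by
    simp only [nominalControl, barrierThree, hq', same_deficit]
  have q_eq := hsol.q_eq_of_const hat.le htb'
  have deficit_eq := hsol.energyDeficit_eq_of_const hk hα hβ sr hat.le htb'
  rw [hq'] at q_eq
  rw [same_deficit, hq'] at deficit_eq
  have admissible := hdwell (q a) (barrierThree P G sr T s q a) _ (t - a) (q' t)
    (barrierThree P G sr T' s' q' t) hqa hba (sub_nonneg.2 hat.le) (sub_lt_iff_lt_add'.2 hlt)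
    rfl q_eq (by simp only [barrierThree, q_eq, deficit_eq, nominalControl]; ring)
  rw [Triggered, same_control] at htrig
  exact htrig.elim (fun hlow => admissible.1.not_gt hlow) fun hup => admissible.2.not_gt hup

theorem IsStefanSolution.barriers_nonneg {a : ℝ} {b : EReal}
    (h : IsStefanSolution P T s q U a b) (hk : P.k ≠ 0) (hα : P.α ≠ 0) (hβ : P.β ≠ 0)
    (hc₂ : 0 < G.c₂) (hδ₂' : G.δ₂ < 1) {c : ℝ} (hac : a ≤ c) (hc : (c : EReal) < b)
    (hdev : ∀ t ∈ Ioo a c, G.AdmissibleDeviation (nominalControl P G sr T s q t - U t)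
      (q t) (barrierThree P G sr T s q t))
    (hqa : 0 ≤ q a) (hba : 0 ≤ barrierThree P G sr T s q a) :
    0 ≤ q c ∧ 0 ≤ barrierThree P G sr T s q c := by
  have hsub := Icc_subset_setOf_coe_lt (a := a) hc
  have barrier_nonneg : ∀ t ∈ Icc a c, 0 ≤ barrierThree P G sr T s q t := fun t ht => by
    refine nonneg_of_le_rightDeriv (c := (1 + G.δ₂) * G.c₂) ht.1
      (h.continuousOn_barrierThree (hsub ht).2)
      (fun r hr => h.hasDerivWithinAt_barrierThree hk hα hβ hr.1
        (hsub ⟨hr.1.le, hr.2.le.trans ht.2⟩).2) (fun r hr => ?_) hba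
    have hlow := (hdev r ⟨hr.1, hr.2.trans_le ht.2⟩).1
    simp only [nominalControl] at hlow
    linarith
  refine ⟨?_, barrier_nonneg c (right_mem_Icc.2 hac)⟩
  refine nonneg_of_le_rightDeriv (c := G.c₁ + G.μ₁) hac (h.q_cont.mono hsub)
    (fun r hr => h.actuator r hr.1.le (hsub (Ioo_subset_Icc_self hr)).2) (fun r hr => ?_) hqa
  have hup := (hdev r hr).2
  have := mul_nonneg (mul_pos (sub_pos.2 hδ₂') hc₂).le (barrier_nonneg r (Ioo_subset_Icc_self hr))
  simp only [nominalControl] at hup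
  linarith

end DwellTime

/-- The safe set of states at time `t`: no point of the liquid is below the melting temperature,
and the barrier functions `h₂ = q` and `h₃` are nonnegative. The point `x = 0` is left out as in the
initial condition; the bound extends to it by continuity. -/
structure IsSafe (P : StefanParams) (G : ETCGains) (sr : ℝ) (T : ℝ → ℝ → ℝ) (s q : ℝ → ℝ)
    (t : ℝ) : Prop where
  melting_le : ∀ x ∈ Ioc 0 (s t), P.Tm ≤ T x t
  q_nonneg : 0 ≤ q t
  barrierThree_nonneg : 0 ≤ barrierThree P G sr T s q t

namespace IsClosedLoopSolution

variable {P : StefanParams} {G : ETCGains} {sr : ℝ} {T : ℝ → ℝ → ℝ} {s q U : ℝ → ℝ}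
  {e : ℕ → EReal} {tEnd : EReal}

theorem not_triggered (h : IsClosedLoopSolution P G sr T s q U e tEnd) {j : ℕ} {a t : ℝ}
    (ha : 0 ≤ a) (hj : e j = a) (hat : a < t) (hte : (t : EReal) < e (j + 1))
    (htE : (t : EReal) < tEnd) : ¬ Triggered P G sr T s q a t := by
  intro htrig
  obtain ⟨b, htb, hb⟩ := EReal.lt_iff_exists_real_btwn.1 (lt_min hte htE)
  have held : IsStefanSolution P T s q (fun _ => nominalControl P G sr T s q a) a b :=
    h.plant.restrict ha (hb.le.trans (min_le_right _ _)) fun r hr hrb =>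
      h.hold j a hj r hr ((hrb.trans hb).trans_le (min_le_left _ _))
        ((hrb.trans hb).trans_le (min_le_right _ _))
  have hmem : t ∈ triggerSet P G sr T s q a :=
    ⟨hat, T, s, q, b, EReal.coe_lt_coe_iff.1 htb, held, rfl, rfl, fun _ _ => rfl, htrig⟩
  rw [h.event_succ j a hj] at hte
  exact hte.not_ge (sInf_le (mem_image_of_mem _ hmem))

theorem add_le_event_succ (h : IsClosedLoopSolution P G sr T s q U e tEnd) {j : ℕ} {a τ : ℝ}
    (hj : e j = a) (hτ : ∀ t ∈ triggerSet P G sr T s q a, a + τ ≤ t) :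
    ((a + τ : ℝ) : EReal) ≤ e (j + 1) := by
  rw [h.event_succ j a hj]
  exact le_sInf (forall_mem_image.2 fun t ht => EReal.coe_le_coe_iff.2 (hτ t ht))

theorem monotone_event (h : IsClosedLoopSolution P G sr T s q U e tEnd) : Monotone e := by
  refine monotone_nat_of_le_succ fun j => ?_
  induction hj : e j with
  | bot => exact bot_le
  | top => exact (h.event_top j hj).ge
  | coe a => simpa using h.add_le_event_succ (τ := 0) hj fun t ht => by simpa using ht.1.le

theorem admissibleDeviation_of_lt_event_succ (h : IsClosedLoopSolution P G sr T s q U e tEnd)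
    (hc₂ : 0 < G.c₂) (hδ₂ : 0 < G.δ₂) (hμ : 0 ≤ G.μ₁) {j : ℕ} {a t : ℝ}
    (ha : 0 ≤ a) (hj : e j = a) (hqa : 0 ≤ q a) (hba : 0 ≤ barrierThree P G sr T s q a)
    (hat : a ≤ t) (hte : (t : EReal) < e (j + 1)) (htE : (t : EReal) < tEnd) :
    G.AdmissibleDeviation (nominalControl P G sr T s q t - U t) (q t)
      (barrierThree P G sr T s q t) := by
  rw [h.hold j a hj t hat hte htE]
  rcases hat.eq_or_lt with rfl | hat
  · have hδb := mul_nonneg (mul_pos hδ₂ hc₂).le hba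
    have hμq := mul_nonneg hμ hqa
    rw [sub_self]
    constructor <;> linarith
  · exact admissibleDeviation_of_not_triggered (h.not_triggered ha hj hat hte htE)

theorem barriers_nonneg_of_le_event_succ (h : IsClosedLoopSolution P G sr T s q U e tEnd)
    (hk : P.k ≠ 0) (hα : P.α ≠ 0) (hβ : P.β ≠ 0) (hc₂ : 0 < G.c₂) (hδ₂ : 0 < G.δ₂)
    (hδ₂' : G.δ₂ < 1) (hμ : 0 ≤ G.μ₁) {j : ℕ} {a t : ℝ}
    (ha : 0 ≤ a) (hj : e j = a) (hqa : 0 ≤ q a) (hba : 0 ≤ barrierThree P G sr T s q a)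
    (hat : a ≤ t) (hte : (t : EReal) ≤ e (j + 1)) (htE : (t : EReal) < tEnd) :
    0 ≤ q t ∧ 0 ≤ barrierThree P G sr T s q t :=
  (h.plant.restrict ha le_rfl fun _ _ _ => rfl).barriers_nonneg hk hα hβ hc₂ hδ₂' hat htE
    (fun _ hr => h.admissibleDeviation_of_lt_event_succ hc₂ hδ₂ hμ ha hj hqa hba hr.1.le
      ((EReal.coe_lt_coe_iff.2 hr.2).trans_le hte) ((EReal.coe_lt_coe_iff.2 hr.2).trans htE))
    hqa hba

theorem exists_event_eq_coe (h : IsClosedLoopSolution P G sr T s q U e tEnd)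
    (hk : P.k ≠ 0) (hα : P.α ≠ 0) (hβ : P.β ≠ 0) (hc₂ : 0 < G.c₂) (hδ₂ : 0 < G.δ₂)
    (hδ₂' : G.δ₂ < 1) (hμ : 0 ≤ G.μ₁) {τ : ℝ} (hτ : 0 ≤ τ)
    (hdwell : ∀ a, 0 ≤ s a → 0 ≤ q a → 0 ≤ barrierThree P G sr T s q a →
      ∀ t ∈ triggerSet P G sr T s q a, a + τ ≤ t)
    (hq : 0 ≤ q 0) (hb : 0 ≤ barrierThree P G sr T s q 0) (j : ℕ) (hjE : e j < tEnd) :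
    ∃ a : ℝ, e j = a ∧ j * τ ≤ a ∧ 0 ≤ q a ∧ 0 ≤ barrierThree P G sr T s q a := by
  induction j with
  | zero => exact ⟨0, h.event_zero, by simp, hq, hb⟩
  | succ j ih =>
    obtain ⟨a, hj, hja, hqa, hba⟩ := ih ((h.monotone_event j.le_succ).trans_lt hjE)
    have ha : 0 ≤ a := (by positivity : (0 : ℝ) ≤ j * τ).trans hja
    have haE : (a : EReal) < tEnd := hj ▸ (h.monotone_event j.le_succ).trans_lt hjE
    have gap := h.add_le_event_succ hj (hdwell a (h.plant.s_pos a ha haE).le hqa hba)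
    obtain ⟨a', hj'⟩ : ∃ a' : ℝ, e (j + 1) = a' :=
      ⟨_, (EReal.coe_toReal hjE.ne_top (ne_bot_of_le_ne_bot (EReal.coe_ne_bot _) gap)).symm⟩
    have haa' : a + τ ≤ a' := EReal.coe_le_coe_iff.1 (hj' ▸ gap)
    refine ⟨a', hj', by push_cast; linarith, ?_⟩
    exact h.barriers_nonneg_of_le_event_succ hk hα hβ hc₂ hδ₂ hδ₂' hμ ha hj hqa hba
      (by linarith) hj'.ge (hj' ▸ hjE)

theorem exists_event_interval (h : IsClosedLoopSolution P G sr T s q U e tEnd)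
    (hk : P.k ≠ 0) (hα : P.α ≠ 0) (hβ : P.β ≠ 0) (hc₁ : 0 < G.c₁) (hc₂ : 0 < G.c₂)
    (hδ₁ : 0 < G.δ₁) (hδ₂ : 0 < G.δ₂) (hδ₂' : G.δ₂ < 1)
    (hq : 0 ≤ q 0) (hb : 0 ≤ barrierThree P G sr T s q 0) {t : ℝ} (ht : 0 ≤ t)
    (htE : (t : EReal) < tEnd) :
    ∃ (j : ℕ) (a : ℝ), e j = a ∧ 0 ≤ a ∧ a ≤ t ∧ (t : EReal) < e (j + 1) ∧
      0 ≤ q a ∧ 0 ≤ barrierThree P G sr T s q a := by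
  classical
  obtain ⟨τ, hτ, hdwell⟩ := exists_add_le_of_mem_triggerSet hk hα hβ hc₁ hc₂ hδ₁ hδ₂ hδ₂' sr
  have event := h.exists_event_eq_coe hk hα hβ hc₂ hδ₂ hδ₂'
    (ETCGains.μ₁_pos hc₁ hc₂ hδ₁ hδ₂').le hτ.le (hdwell T s q) hq hb
  have no_zeno : ∃ n, (t : EReal) < e n := by
    obtain ⟨n, hn⟩ := exists_nat_gt (t / τ)
    refine ⟨n, (lt_or_ge (e n) tEnd).elim (fun hnE => ?_) htE.trans_le⟩
    obtain ⟨a, hna, hle, -⟩ := event n hnE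
    rw [hna, EReal.coe_lt_coe_iff]
    exact ((div_lt_iff₀ hτ).1 hn).trans_le hle
  have hfirst : Nat.find no_zeno ≠ 0 := fun h0 =>
    ((Nat.find_eq_zero no_zeno).1 h0).not_ge (h.event_zero ▸ EReal.coe_nonneg.2 ht)
  obtain ⟨j, hj⟩ := Nat.exists_eq_succ_of_ne_zero hfirst
  have hjt : e j ≤ t := not_lt.1 (Nat.find_min no_zeno (hj ▸ j.lt_succ_self))
  obtain ⟨a, hja, hle, hqa, hba⟩ := event j (hjt.trans_lt htE)
  exact ⟨j, a, hja, (by positivity : (0 : ℝ) ≤ j * τ).trans hle,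
    EReal.coe_le_coe_iff.1 (hja ▸ hjt), (Nat.find_spec no_zeno).trans_eq (congrArg e hj), hqa, hba⟩

theorem isSafe (h : IsClosedLoopSolution P G sr T s q U e tEnd)
    (hk : 0 < P.k) (hα : 0 < P.α) (hβ : P.β ≠ 0) (hc₁ : 0 < G.c₁) (hc₂ : 0 < G.c₂)
    (hδ₁ : 0 < G.δ₁) (hδ₂ : 0 < G.δ₂) (hδ₂' : G.δ₂ < 1) (h0 : IsSafe P G sr T s q 0) {t : ℝ}
    (ht : 0 ≤ t) (htE : (t : EReal) < tEnd) : IsSafe P G sr T s q t := by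
  have barriers : ∀ r ∈ Icc 0 t, 0 ≤ q r ∧ 0 ≤ barrierThree P G sr T s q r := fun r hr => by
    have hrE := (EReal.coe_le_coe_iff.2 hr.2).trans_lt htE
    obtain ⟨j, a, hja, ha, har, hre, hqa, hba⟩ := h.exists_event_interval hk.ne' hα.ne' hβ hc₁ hc₂
      hδ₁ hδ₂ hδ₂' h0.q_nonneg h0.barrierThree_nonneg hr.1 hrE
    exact h.barriers_nonneg_of_le_event_succ hk.ne' hα.ne' hβ hc₂ hδ₂ hδ₂'
      (ETCGains.μ₁_pos hc₁ hc₂ hδ₁ hδ₂').le ha hja hqa hba har hre.le hrE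
  refine ⟨fun x hx => ?_, (barriers t (right_mem_Icc.2 ht)).1, (barriers t (right_mem_Icc.2 ht)).2⟩
  exact h.plant.melting_le hk hα ht htE (fun r hr => (barriers r (Ioo_subset_Icc_self hr)).1)
    h0.melting_le x (Ioc_subset_Icc_self hx)

theorem admissibleDeviation (h : IsClosedLoopSolution P G sr T s q U e tEnd)
    (hk : P.k ≠ 0) (hα : P.α ≠ 0) (hβ : P.β ≠ 0) (hc₁ : 0 < G.c₁) (hc₂ : 0 < G.c₂)
    (hδ₁ : 0 < G.δ₁) (hδ₂ : 0 < G.δ₂) (hδ₂' : G.δ₂ < 1)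
    (hq : 0 ≤ q 0) (hb : 0 ≤ barrierThree P G sr T s q 0) {t : ℝ} (ht : 0 ≤ t)
    (htE : (t : EReal) < tEnd) :
    G.AdmissibleDeviation (nominalControl P G sr T s q t - U t) (q t)
      (barrierThree P G sr T s q t) := by
  obtain ⟨j, a, hja, ha, hat, hte, hqa, hba⟩ :=
    h.exists_event_interval hk hα hβ hc₁ hc₂ hδ₁ hδ₂ hδ₂' hq hb ht htE
  exact h.admissibleDeviation_of_lt_event_succ hc₂ hδ₂ (ETCGains.μ₁_pos hc₁ hc₂ hδ₁ hδ₂').le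
    ha hja hqa hba hat hte htE

end IsClosedLoopSolution

namespace ETCGains

/-- The decay rate of `barrierLyapunov` along the closed loop. -/
noncomputable def rate (G : ETCGains) : ℝ :=
  G.c₁ * min G.c₁ ((1 - G.δ₂) * G.c₂) / (G.μ₁ + 2 * G.c₁)

theorem rate_pos {G : ETCGains} (hc₁ : 0 < G.c₁) (hc₂ : 0 < G.c₂) (hδ₁ : 0 < G.δ₁)
    (hδ₂' : G.δ₂ < 1) : 0 < G.rate := by
  have hμ : 0 < G.μ₁ := μ₁_pos hc₁ hc₂ hδ₁ hδ₂'
  have : 0 < min G.c₁ ((1 - G.δ₂) * G.c₂) := lt_min hc₁ (mul_pos (sub_pos.2 hδ₂') hc₂)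
  unfold rate
  positivity

end ETCGains

/-- The weight of `V²`, with `V` the function `barrierLyapunov`, in the Lyapunov function
`‖T - Tm‖² + K V²` of the closed loop: with this `K` the decay of `V²` absorbs the heat input. -/
noncomputable def lyapunovWeight (P : StefanParams) (G : ETCGains) (sr : ℝ) : ℝ :=
  P.α * sr / P.k ^ 2 / G.rate

theorem lyapunovWeight_pos {P : StefanParams} {G : ETCGains} {sr : ℝ} (hk : P.k ≠ 0)
    (hα : 0 < P.α) (hsr : 0 < sr) (hc₁ : 0 < G.c₁) (hc₂ : 0 < G.c₂) (hδ₁ : 0 < G.δ₁)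
    (hδ₂' : G.δ₂ < 1) : 0 < lyapunovWeight P G sr := by
  have hrate : 0 < G.rate := ETCGains.rate_pos hc₁ hc₂ hδ₁ hδ₂'
  unfold lyapunovWeight
  positivity

/-- The Lyapunov function `V = (μ₁ + c₁) σ + h₃` of the lumped states `(σ, q)`. It is linear, so
on the safe set it is comparable to `h₂ + h₃`; the weight `μ₁` cancels the term `μ₁ h₂` which the
triggering rule allows in the input. -/
noncomputable def barrierLyapunov (P : StefanParams) (G : ETCGains) (sr : ℝ) (T : ℝ → ℝ → ℝ)
    (s q : ℝ → ℝ) (t : ℝ) : ℝ :=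
  (G.μ₁ + G.c₁) * energyDeficit P sr T s t + barrierThree P G sr T s q t

section BarrierLyapunov

variable {P : StefanParams} {G : ETCGains} {sr : ℝ} {T : ℝ → ℝ → ℝ} {s q U : ℝ → ℝ} {t : ℝ}

theorem sub_setpoint_eq (hk : P.k ≠ 0) (hα : P.α ≠ 0) (hβ : P.β ≠ 0) :
    s t - sr = -(P.β / P.k * energyDeficit P sr T s t
      + P.β / P.α * ∫ x in (0 : ℝ)..s t, (T x t - P.Tm)) := by
  simp only [energyDeficit]
  field_simp
  ring

namespace IsSafe

theorem integral_nonneg (h : IsSafe P G sr T s q t) (hs : 0 ≤ s t) :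
    0 ≤ ∫ x in (0 : ℝ)..s t, (T x t - P.Tm) := by
  rw [intervalIntegral.integral_of_le hs]
  exact setIntegral_nonneg measurableSet_Ioc fun x hx => sub_nonneg.2 (h.melting_le x hx)

theorem energyDeficit_nonneg (h : IsSafe P G sr T s q t) (hc₁ : 0 < G.c₁) :
    0 ≤ energyDeficit P sr T s t := by
  have hb := h.barrierThree_nonneg
  rw [barrierThree] at hb
  exact nonneg_of_mul_nonneg_right (by linarith [h.q_nonneg]) hc₁

theorem s_le (h : IsSafe P G sr T s q t) (hk : 0 < P.k) (hα : 0 < P.α) (hβ : 0 < P.β)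
    (hc₁ : 0 < G.c₁) (hs : 0 ≤ s t) : s t ≤ sr := by
  have hσ := h.energyDeficit_nonneg hc₁
  have hI := h.integral_nonneg hs
  rw [← sub_nonpos, sub_setpoint_eq hk.ne' hα.ne' hβ.ne', neg_nonpos]
  positivity

theorem mul_energyDeficit_le_barrierLyapunov (h : IsSafe P G sr T s q t) (hc₁ : 0 < G.c₁)
    (hμ : 0 ≤ G.μ₁) : G.c₁ * energyDeficit P sr T s t ≤ barrierLyapunov P G sr T s q t := by
  have := mul_nonneg hμ (h.energyDeficit_nonneg hc₁)
  have := h.barrierThree_nonneg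
  rw [barrierLyapunov]
  linarith

theorem q_le_barrierLyapunov (h : IsSafe P G sr T s q t) (hc₁ : 0 < G.c₁) (hμ : 0 ≤ G.μ₁) :
    q t ≤ barrierLyapunov P G sr T s q t := by
  have hb := h.barrierThree_nonneg
  rw [barrierThree] at hb
  linarith [h.mul_energyDeficit_le_barrierLyapunov hc₁ hμ]

theorem rate_mul_barrierLyapunov_le (h : IsSafe P G sr T s q t) (hc₁ : 0 < G.c₁)
    (hc₂ : 0 < G.c₂) (hδ₂' : G.δ₂ < 1) (hμ : 0 ≤ G.μ₁) :
    G.rate * barrierLyapunov P G sr T s q t ≤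
      G.c₁ * q t + (1 - G.δ₂) * G.c₂ * barrierThree P G sr T s q t := by
  have hq := h.q_nonneg
  have hb := h.barrierThree_nonneg
  have : 0 ≤ min G.c₁ ((1 - G.δ₂) * G.c₂) :=
    le_min hc₁.le (mul_pos (sub_pos.2 hδ₂') hc₂).le
  have lyapunov_le : G.c₁ * barrierLyapunov P G sr T s q t ≤
      (G.μ₁ + 2 * G.c₁) * (q t + barrierThree P G sr T s q t) := by
    rw [barrierLyapunov, barrierThree]
    linear_combination mul_nonneg hc₁.le hq
  calc G.rate * barrierLyapunov P G sr T s q t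
      = min G.c₁ ((1 - G.δ₂) * G.c₂) / (G.μ₁ + 2 * G.c₁) *
          (G.c₁ * barrierLyapunov P G sr T s q t) := by rw [ETCGains.rate]; ring
    _ ≤ min G.c₁ ((1 - G.δ₂) * G.c₂) / (G.μ₁ + 2 * G.c₁) *
          ((G.μ₁ + 2 * G.c₁) * (q t + barrierThree P G sr T s q t)) := by gcongr
    _ = min G.c₁ ((1 - G.δ₂) * G.c₂) * q t +
          min G.c₁ ((1 - G.δ₂) * G.c₂) * barrierThree P G sr T s q t := by field_simp
    _ ≤ _ := by
      gcongr
      exacts [min_le_left _ _, min_le_right _ _]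

theorem deriv_barrierLyapunov_le (h : IsSafe P G sr T s q t) (hc₁ : 0 < G.c₁) (hc₂ : 0 < G.c₂)
    (hδ₂' : G.δ₂ < 1) (hμ : 0 ≤ G.μ₁)
    (hdev : G.AdmissibleDeviation (nominalControl P G sr T s q t - U t) (q t)
      (barrierThree P G sr T s q t)) :
    (G.μ₁ + G.c₁) * -q t + (-U t + G.c₁ * -q t) ≤ -G.rate * barrierLyapunov P G sr T s q t := by
  have hup := hdev.2
  rw [nominalControl] at hup
  linarith [h.rate_mul_barrierLyapunov_le hc₁ hc₂ hδ₂' hμ]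

theorem sub_setpoint_sq_le (h : IsSafe P G sr T s q t) (hk : 0 < P.k) (hα : 0 < P.α)
    (hβ : 0 < P.β) (hc₁ : 0 < G.c₁) (hμ : 0 ≤ G.μ₁) (hs : 0 ≤ s t)
    (hT : ContinuousOn (fun x => T x t - P.Tm) (Icc 0 (s t))) :
    (s t - sr) ^ 2 ≤
      2 * ((P.β / (P.k * G.c₁)) ^ 2 * barrierLyapunov P G sr T s q t ^ 2 +
        (P.β / P.α) ^ 2 * (sr * ∫ x in (0 : ℝ)..s t, (T x t - P.Tm) ^ 2)) := by
  have hσ := h.energyDeficit_nonneg hc₁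
  have integral_sq : (∫ x in (0 : ℝ)..s t, (T x t - P.Tm)) ^ 2 ≤
      sr * ∫ x in (0 : ℝ)..s t, (T x t - P.Tm) ^ 2 :=
    (sq_intervalIntegral_le hs hT).trans (mul_le_mul_of_nonneg_right
      ((sub_zero _).trans_le (h.s_le hk hα hβ hc₁ hs))
      (intervalIntegral.integral_nonneg hs fun _ _ => sq_nonneg _))
  have deficit_sq : (G.c₁ * energyDeficit P sr T s t) ^ 2 ≤ barrierLyapunov P G sr T s q t ^ 2 :=
    pow_le_pow_left₀ (by positivity) (h.mul_energyDeficit_le_barrierLyapunov hc₁ hμ) 2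
  calc (s t - sr) ^ 2
      = (P.β / (P.k * G.c₁) * (G.c₁ * energyDeficit P sr T s t) +
          P.β / P.α * ∫ x in (0 : ℝ)..s t, (T x t - P.Tm)) ^ 2 := by
        rw [sub_setpoint_eq hk.ne' hα.ne' hβ.ne', neg_sq]
        field_simp
    _ ≤ 2 * ((P.β / (P.k * G.c₁)) ^ 2 * (G.c₁ * energyDeficit P sr T s t) ^ 2 +
          (P.β / P.α) ^ 2 * (∫ x in (0 : ℝ)..s t, (T x t - P.Tm)) ^ 2) := by
        rw [← mul_pow, ← mul_pow]
        exact add_sq_le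
    _ ≤ _ := by gcongr

theorem stabilityNorm_le (h : IsSafe P G sr T s q t) (hk : 0 < P.k) (hα : 0 < P.α)
    (hβ : 0 < P.β) (hc₁ : 0 < G.c₁) (hμ : 0 ≤ G.μ₁) (hs : 0 ≤ s t)
    (hT : ContinuousOn (fun x => T x t - P.Tm) (Icc 0 (s t))) :
    stabilityNorm P sr T s q t ≤
      (1 + 2 * (P.β / P.α) ^ 2 * sr + 2 * (P.β / (P.k * G.c₁)) ^ 2) *
        ((∫ x in (0 : ℝ)..s t, (T x t - P.Tm) ^ 2) + barrierLyapunov P G sr T s q t ^ 2) := by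
  have hsr : 0 ≤ sr := hs.trans (h.s_le hk hα hβ hc₁ hs)
  have hY : 0 ≤ ∫ x in (0 : ℝ)..s t, (T x t - P.Tm) ^ 2 :=
    intervalIntegral.integral_nonneg hs fun _ _ => sq_nonneg _
  have q_sq : q t ^ 2 ≤ barrierLyapunov P G sr T s q t ^ 2 :=
    pow_le_pow_left₀ h.q_nonneg (h.q_le_barrierLyapunov hc₁ hμ) 2
  have cross : 0 ≤ (P.β / P.α) ^ 2 * sr * barrierLyapunov P G sr T s q t ^ 2 +
      (P.β / (P.k * G.c₁)) ^ 2 * ∫ x in (0 : ℝ)..s t, (T x t - P.Tm) ^ 2 := by positivity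
  rw [stabilityNorm]
  linarith [h.sub_setpoint_sq_le hk hα hβ hc₁ hμ hs hT]

theorem integral_sq_add_barrierLyapunov_sq_le (h : IsSafe P G sr T s q t) (hk : 0 < P.k)
    (hα : 0 < P.α) (hc₁ : 0 < G.c₁) (hμ : 0 ≤ G.μ₁) (hs : 0 ≤ s t) :
    (∫ x in (0 : ℝ)..s t, (T x t - P.Tm) ^ 2) + barrierLyapunov P G sr T s q t ^ 2 ≤
      (1 + ((G.μ₁ + 2 * G.c₁) * (P.k / P.β)) ^ 2) * stabilityNorm P sr T s q t := by
  set g := (G.μ₁ + 2 * G.c₁) * (P.k / P.β) with hg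
  have hq := h.q_nonneg
  have deficit_le : energyDeficit P sr T s t ≤ P.k / P.β * (sr - s t) := by
    have := mul_nonneg (div_nonneg hk.le hα.le) (h.integral_nonneg hs)
    rw [energyDeficit]
    linarith
  have lyapunov_le : barrierLyapunov P G sr T s q t ≤ g * (sr - s t) := by
    have := mul_le_mul_of_nonneg_left deficit_le (show 0 ≤ G.μ₁ + 2 * G.c₁ by positivity)
    rw [barrierLyapunov, barrierThree, hg]
    linarith
  have lyapunov_sq := pow_le_pow_left₀ (hq.trans (h.q_le_barrierLyapunov hc₁ hμ)) lyapunov_le 2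
  have hY : 0 ≤ ∫ x in (0 : ℝ)..s t, (T x t - P.Tm) ^ 2 :=
    intervalIntegral.integral_nonneg hs fun _ _ => sq_nonneg _
  rw [stabilityNorm]
  linear_combination lyapunov_sq + mul_nonneg (sq_nonneg g) (add_nonneg hY (sq_nonneg (q t))) +
    sq_nonneg (q t) + sq_nonneg (s t - sr)

end IsSafe

theorem IsStefanSolution.hasDerivWithinAt_barrierLyapunov {a : ℝ} {b : EReal}
    (h : IsStefanSolution P T s q U a b) (hk : P.k ≠ 0) (hα : P.α ≠ 0) (hβ : P.β ≠ 0)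
    (ht : a < t) (htb : (t : EReal) < b) :
    HasDerivWithinAt (barrierLyapunov P G sr T s q)
      ((G.μ₁ + G.c₁) * -q t + (-U t + G.c₁ * -q t)) (Ici t) t :=
  ((h.hasDerivAt_energyDeficit hk hα hβ sr ht htb).hasDerivWithinAt.const_mul _).add
    (h.hasDerivWithinAt_barrierThree hk hα hβ ht htb)

theorem IsStefanSolution.continuousOn_barrierLyapunov {a : ℝ} {b : EReal}
    (h : IsStefanSolution P T s q U a b) {c : ℝ} (hc : (c : EReal) < b) :
    ContinuousOn (barrierLyapunov P G sr T s q) (Icc a c) :=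
  ((h.continuousOn_energyDeficit sr hc).const_mul _).add (h.continuousOn_barrierThree hc)

end BarrierLyapunov

namespace IsClosedLoopSolution

variable {P : StefanParams} {G : ETCGains} {sr : ℝ} {T : ℝ → ℝ → ℝ} {s q U : ℝ → ℝ}
  {e : ℕ → EReal} {tEnd : EReal}

theorem weighted_sum_le_mul_exp (h : IsClosedLoopSolution P G sr T s q U e tEnd)
    (hk : 0 < P.k) (hα : 0 < P.α) (hβ : 0 < P.β) (hsr : 0 ≤ sr) (hc₁ : 0 < G.c₁)
    (hc₂ : 0 < G.c₂) (hδ₁ : 0 < G.δ₁) (hδ₂ : 0 < G.δ₂) (hδ₂' : G.δ₂ < 1)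
    (h0 : IsSafe P G sr T s q 0) {t : ℝ} (ht : 0 ≤ t) (htE : (t : EReal) < tEnd) :
    (∫ x in (0 : ℝ)..s t, (T x t - P.Tm) ^ 2)
        + lyapunovWeight P G sr * barrierLyapunov P G sr T s q t ^ 2 ≤
      ((∫ x in (0 : ℝ)..s 0, (T x 0 - P.Tm) ^ 2)
        + lyapunovWeight P G sr * barrierLyapunov P G sr T s q 0 ^ 2) *
      Real.exp (-min (P.α / sr ^ 2) G.rate * t) := by
  have hμ : 0 ≤ G.μ₁ := (ETCGains.μ₁_pos hc₁ hc₂ hδ₁ hδ₂').le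
  have hlt : ∀ r ∈ Ioo 0 t, (r : EReal) < tEnd := fun r hr =>
    (EReal.coe_lt_coe_iff.2 hr.2).trans htE
  have hs : ∀ r ∈ Ioo 0 t, 0 ≤ s r := fun r hr => (h.plant.s_pos r hr.1.le (hlt r hr)).le
  have safe : ∀ r ∈ Ioo 0 t, IsSafe P G sr T s q r := fun r hr =>
    h.isSafe hk hα hβ.ne' hc₁ hc₂ hδ₁ hδ₂ hδ₂' h0 hr.1.le (hlt r hr)
  have cascade := add_sq_le_mul_exp_of_cascade (κ := P.α / sr ^ 2)
    (ETCGains.rate_pos hc₁ hc₂ hδ₁ hδ₂') (show 0 ≤ P.α * sr / P.k ^ 2 by positivity) ht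
    (h.plant.continuousOn_integral (φ := fun x => x ^ 2) (by fun_prop) htE)
    (h.plant.continuousOn_barrierLyapunov (G := G) (sr := sr) htE)
    (fun r hr => (h.plant.hasDerivAt_integral_sq hr.1 (hlt r hr)).hasDerivWithinAt)
    (fun r hr => h.plant.hasDerivWithinAt_barrierLyapunov hk.ne' hα.ne' hβ.ne' hr.1 (hlt r hr))
    (fun r hr => intervalIntegral.integral_nonneg (hs r hr) fun _ _ => sq_nonneg _)
    (fun r hr => (safe r hr).q_nonneg.trans ((safe r hr).q_le_barrierLyapunov hc₁ hμ))
    (fun r hr => ?_)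
    (fun r hr => (safe r hr).deriv_barrierLyapunov_le hc₁ hc₂ hδ₂' hμ
      (h.admissibleDeviation hk.ne' hα.ne' hβ.ne' hc₁ hc₂ hδ₁ hδ₂ hδ₂' h0.q_nonneg
        h0.barrierThree_nonneg hr.1.le (hlt r hr)))
  · simpa only [lyapunovWeight, sub_zero] using cascade
  · have q_sq := pow_le_pow_left₀ (safe r hr).q_nonneg
      ((safe r hr).q_le_barrierLyapunov hc₁ hμ) 2
    exact (h.plant.dissipation_le hk.ne' hα hr.1 (hlt r hr)
      ((safe r hr).s_le hk hα hβ hc₁ (hs r hr))).trans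
      (add_le_add_right (mul_le_mul_of_nonneg_left q_sq (by positivity)) _)

theorem stabilityNorm_le_mul_exp (h : IsClosedLoopSolution P G sr T s q U e tEnd)
    (hk : 0 < P.k) (hα : 0 < P.α) (hβ : 0 < P.β) (hsr : 0 < sr) (hc₁ : 0 < G.c₁)
    (hc₂ : 0 < G.c₂) (hδ₁ : 0 < G.δ₁) (hδ₂ : 0 < G.δ₂) (hδ₂' : G.δ₂ < 1)
    (h0 : IsSafe P G sr T s q 0) {t : ℝ} (ht : 0 ≤ t) (htE : (t : EReal) < tEnd) :
    stabilityNorm P sr T s q t ≤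
      (1 + 2 * (P.β / P.α) ^ 2 * sr + 2 * (P.β / (P.k * G.c₁)) ^ 2) *
        (1 + 1 / lyapunovWeight P G sr) * (1 + lyapunovWeight P G sr) *
        (1 + ((G.μ₁ + 2 * G.c₁) * (P.k / P.β)) ^ 2) * stabilityNorm P sr T s q 0 *
        Real.exp (-min (P.α / sr ^ 2) G.rate * t) := by
  have hμ : 0 ≤ G.μ₁ := (ETCGains.μ₁_pos hc₁ hc₂ hδ₁ hδ₂').le
  have hK : 0 < lyapunovWeight P G sr :=
    lyapunovWeight_pos hk.ne' hα hsr hc₁ hc₂ hδ₁ hδ₂'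
  have h0E : ((0 : ℝ) : EReal) < tEnd := (EReal.coe_le_coe_iff.2 ht).trans_lt htE
  have hst := (h.plant.s_pos t ht htE).le
  have hs0 := (h.plant.s_pos 0 le_rfl h0E).le
  have upper := (h.isSafe hk hα hβ.ne' hc₁ hc₂ hδ₁ hδ₂ hδ₂' h0 ht htE).stabilityNorm_le hk hα hβ
    hc₁ hμ hst (h.plant.continuousOn_temperature_sub ht htE)
  have lower := h0.integral_sq_add_barrierLyapunov_sq_le hk hα hc₁ hμ hs0
  have decay := h.weighted_sum_le_mul_exp hk hα hβ hsr.le hc₁ hc₂ hδ₁ hδ₂ hδ₂' h0 ht htE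
  generalize lyapunovWeight P G sr = K at *
  have hYt : 0 ≤ ∫ x in (0 : ℝ)..s t, (T x t - P.Tm) ^ 2 :=
    intervalIntegral.integral_nonneg hst fun _ _ => sq_nonneg _
  have hY0 : 0 ≤ ∫ x in (0 : ℝ)..s 0, (T x 0 - P.Tm) ^ 2 :=
    intervalIntegral.integral_nonneg hs0 fun _ _ => sq_nonneg _
  generalize hm : 1 + 2 * (P.β / P.α) ^ 2 * sr + 2 * (P.β / (P.k * G.c₁)) ^ 2 = m at *
  have hm0 : 0 < m := by rw [← hm]; positivity
  calc stabilityNorm P sr T s q t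
      ≤ m * ((∫ x in (0 : ℝ)..s t, (T x t - P.Tm) ^ 2) + barrierLyapunov P G sr T s q t ^ 2) :=
        upper
    _ ≤ m * ((1 + 1 / K) * ((∫ x in (0 : ℝ)..s t, (T x t - P.Tm) ^ 2) +
          K * barrierLyapunov P G sr T s q t ^ 2)) := by
        gcongr
        exact add_le_mul_add_mul hYt (sq_nonneg _) hK
    _ ≤ m * ((1 + 1 / K) * (((∫ x in (0 : ℝ)..s 0, (T x 0 - P.Tm) ^ 2) +
          K * barrierLyapunov P G sr T s q 0 ^ 2) *
          Real.exp (-min (P.α / sr ^ 2) G.rate * t))) := by gcongr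
    _ ≤ m * ((1 + 1 / K) * ((1 + K) * ((∫ x in (0 : ℝ)..s 0, (T x 0 - P.Tm) ^ 2) +
          barrierLyapunov P G sr T s q 0 ^ 2) *
          Real.exp (-min (P.α / sr ^ 2) G.rate * t))) := by
        gcongr
        exact add_mul_le_mul_add hY0 (sq_nonneg _) hK.le
    _ ≤ m * ((1 + 1 / K) * ((1 + K) * ((1 + ((G.μ₁ + 2 * G.c₁) * (P.k / P.β)) ^ 2) *
          stabilityNorm P sr T s q 0) * Real.exp (-min (P.α / sr ^ 2) G.rate * t))) := by
        gcongr
    _ = _ := by ring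

end IsClosedLoopSolution

theorem mainTheorem2_general
    (P : StefanParams) (hk : 0 < P.k) (hα : 0 < P.α) (hβ : 0 < P.β) (sr : ℝ)
    (G : ETCGains) (hc₁ : 0 < G.c₁) (hc₂ : 0 < G.c₂) (hδ₁ : 0 < G.δ₁)
    (hδ₂ : 0 < G.δ₂) (hδ₂' : G.δ₂ < 1) :
    ∃ M : ℝ, 0 < M ∧ ∃ b : ℝ, 0 < b ∧
      ∀ (T : ℝ → ℝ → ℝ) (s q U : ℝ → ℝ) (e : ℕ → EReal) (tEnd : EReal),
        IsClosedLoopSolution P G sr T s q U e tEnd → IsSafe P G sr T s q 0 →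
        ∀ t : ℝ, 0 ≤ t → (t : EReal) < tEnd →
          stabilityNorm P sr T s q t ≤
            M * stabilityNorm P sr T s q 0 * Real.exp (-b * t) := by
  have hrate : 0 < G.rate := ETCGains.rate_pos hc₁ hc₂ hδ₁ hδ₂'
  rcases le_or_gt sr 0 with hsr | hsr
  · refine ⟨1, one_pos, 1, one_pos, fun T s q U e tEnd h h0 t ht htE => ?_⟩
    have hs := h.plant.s_pos 0 le_rfl ((EReal.coe_le_coe_iff.2 ht).trans_lt htE)
    exact absurd (h0.s_le hk hα hβ hc₁ hs.le) (hsr.trans_lt hs).not_ge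
  · have hK := lyapunovWeight_pos hk.ne' hα hsr hc₁ hc₂ hδ₁ hδ₂'
    exact ⟨_, by positivity, min (P.α / sr ^ 2) G.rate, lt_min (by positivity) hrate,
      fun _ _ _ _ _ _ h h0 _ ht htE =>
        h.stabilityNorm_le_mul_exp hk hα hβ hsr hc₁ hc₂ hδ₁ hδ₂ hδ₂' h0 ht htE⟩

theorem mainTheorem2
    (P : StefanParams) (hk : 0 < P.k) (hα : 0 < P.α) (hβ : 0 < P.β)
    (L sr : ℝ) (hsr : sr < L)
    (G : ETCGains) (hc₁ : 0 < G.c₁) (hc₂ : 0 < G.c₂) (hδ₁ : 0 < G.δ₁)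
    (hδ₂ : 0 < G.δ₂) (hδ₂' : G.δ₂ < 1) :
    ∃ M : ℝ, 0 < M ∧ ∃ b : ℝ, 0 < b ∧
      ∀ (s₀ : ℝ) (T₀ : ℝ → ℝ)
        (T : ℝ → ℝ → ℝ) (s q U : ℝ → ℝ) (e : ℕ → EReal) (tEnd : EReal),
        -- initial data
        0 < s₀ → s₀ < L →
        ContDiffOn ℝ 1 T₀ (Set.Icc 0 s₀) →
        (∀ x ∈ Set.Icc 0 s₀, P.Tm ≤ T₀ x) → T₀ s₀ = P.Tm →
        s 0 = s₀ → (∀ x ∈ Set.Ioc 0 s₀, T x 0 = T₀ x) →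
        0 ≤ q 0 →
        -- setpoint restriction
        s₀ + P.β / P.α * (∫ x in (0 : ℝ)..s₀, (T₀ x - P.Tm)) ≤ sr →
        -- gain condition
        q 0 ≤ G.c₁ * energyDeficit P sr T s 0 →
        IsClosedLoopSolution P G sr T s q U e tEnd →
        ∀ t : ℝ, 0 ≤ t → (t : EReal) < tEnd →
          stabilityNorm P sr T s q t ≤
            M * stabilityNorm P sr T s q 0 * Real.exp (-b * t) := by
  obtain ⟨M, hM, b, hb, decay⟩ :=
    mainTheorem2_general P hk hα hβ sr G hc₁ hc₂ hδ₁ hδ₂ hδ₂'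
  refine ⟨M, hM, b, hb, ?_⟩
  rintro _ T₀ T s q U e tEnd _ _ _ hT₀ _ rfl hT hq _ hgain h
  exact decay T s q U e tEnd h
    ⟨fun x hx => hT x hx ▸ hT₀ x (Ioc_subset_Icc_self hx), hq, le_neg_add_iff_add_le.2 (by simpa)⟩
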